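/- **Conventions.** All systems are qubits and $|0\rangle,|1\rangle$ is the standard basis of $\mathbb C^2$. *Orthogonal product matrices.* A matrix below with $n$ columns denotes a set of $n$-qubit product states, one for each row: a row $(v_1,\dots,v_n)$ denotes $|v_1\rangle\otimes\dots\otimes|v_n\rangle$. A letter $v\in\{a,b,c,d,e,x,y\}$ is a vector variable: $\{|v\rangle,|v'\rangle\}$ is an arbitrary orthonormal basis of $\mathbb C^2$, and the same letter has the same value everywhere in one matrix. A row with a star $*$ stands for two rows, in which the star is replaced by the two vectors of an arbitrary orthonormal basis of $\mathbb C^2$; the bases for different rows are chosen independently of each other and of the letters. For every choice of these bases, each of the matrices $M_{41},\dots,M_{433}$ gives an orthogonal product basis (OPB) of $(\mathbb C^2)^{\otimes 4}$ (16 states), and $M_{32},M_{33}$ give OPBs of $(\mathbb C^2)^{\otimes 3}$. *Equivalence.* Two sets $\mathcal A,\mathcal B$ of $n$-qubit states are equivalent if, for some permutation $\sigma$ of the $n$ systems and some product unitary $U=U_1\otimes\dots\otimes U_n$, applying first $\sigma$ and then $U$ turns $\mathcal A$ into $\mathcal B$ up to nonzero scalar factors of the states. *Local distinguishability.* A set of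 $n$-qubit states is locally distinguishable if there is an LOCC protocol that identifies with certainty an unknown state from the set. The protocol is a finite tree of measurements: in each step one party, depending on all earlier outcomes, performs on its qubit together with a local ancilla (of finite dimension, initially in a fixed pure state) a measurement with finitely many Kraus operators $K_k$, $\sum_kK_k^\dagger K_k=I$, and broadcasts the outcome; when the protocol ends, at most one state of the set is compatible with the outcomes, that is, has a nonzero post-measurement vector. Otherwise the set is locally indistinguishable. *The three-qubit matrices:* $$M_{32}=\begin{bmatrix}0 & 0 & *\\ 0 & 1 & *\\ 1 & e & *\\ 1 & e' & *\end{bmatrix}$$ $$M_{33}=\begin{bmatrix}0 & 0 & *\\ 0 & 1 & *\\ 1 & * & e\\ 1 & * & e'\end{bmatrix}$$ *The four-qubit matrices:* $$M_{41}=\begin{bmatrix}0 & 0 & 0 & *\\ 0 & 0 & 1 & *\\ 0 & 1 & c & *\\ 0 & 1 & c' & *\\ 1 & b & x & *\\ 1 & b & x' & *\\ 1 & b' & y & *\\ 1 & b' & y' & *\end{bmatrix}$$ $$M_{42}=\begin{bmatrix}0 & 0 & * & 0\\ 0 & 0 & * & 1\\ 0 & 1 & 0 & *\\ 0 & 1 &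 1 & *\\ 1 & b & c & *\\ 1 & b & c' & *\\ 1 & b' & x & *\\ 1 & b' & x' & *\end{bmatrix}$$ $$M_{43}=\begin{bmatrix}0 & 0 & 0 & *\\ 0 & 0 & 1 & *\\ 0 & 1 & * & 0\\ 0 & 1 & * & 1\\ 1 & b & * & d\\ 1 & b & * & d'\\ 1 & b' & c & *\\ 1 & b' & c' & *\end{bmatrix}$$ $$M_{44}=\begin{bmatrix}0 & 0 & 0 & *\\ 0 & 0 & 1 & *\\ 0 & 1 & c & *\\ 0 & 1 & c' & *\\ 1 & b & * & 0\\ 1 & b & * & 1\\ 1 & b' & * & d\\ 1 & b' & * & d'\end{bmatrix}$$ $$M_{45}=\begin{bmatrix}0 & 0 & * & 0\\ 0 & 0 & * & 1\\ 0 & 1 & c & *\\ 0 & 1 & c' & *\\ 1 & b & 0 & *\\ 1 & b' & 0 & *\\ 1 & x & 1 & *\\ 1 & x' & 1 & *\end{bmatrix}$$ $$M_{46}=\begin{bmatrix}0 & 0 & * & 0\\ 0 & 0 & * & 1\\ 0 & 1 & * & d\\ 0 & 1 & * & d'\\ 1 & b & 0 & *\\ 1 & b' & 0 & *\\ 1 &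 x & 1 & *\\ 1 & x' & 1 & *\end{bmatrix}$$ $$M_{47}=\begin{bmatrix}0 & 0 & c & *\\ 0 & 0 & c' & *\\ 0 & 1 & x & *\\ 0 & 1 & x' & *\\ 1 & b & 0 & 0\\ 1 & * & 1 & 0\\ 1 & b & * & 1\\ 1 & b' & 0 & *\\ 1 & b' & 1 & 1\end{bmatrix}$$ $$M_{48}=\begin{bmatrix}0 & 0 & * & d\\ 0 & 0 & * & d'\\ 0 & 1 & c & *\\ 0 & 1 & c' & *\\ 1 & * & 1 & 0\\ 1 & b & 0 & 0\\ 1 & b & * & 1\\ 1 & b' & 0 & *\\ 1 & b' & 1 & 1\end{bmatrix}$$ $$M_{49}=\begin{bmatrix}0 & 0 & 0 & *\\ 0 & b & 1 & *\\ 0 & b' & 1 & *\\ 1 & 0 & c & *\\ 1 & 0 & c' & *\\ 1 & 1 & 1 & *\\ a & 1 & 0 & *\\ a' & 1 & 0 & *\end{bmatrix}$$ $$M_{410}=\begin{bmatrix}0 & 0 & 0 & *\\ 0 & b & 1 & *\\ 0 & b' & 1 & *\\ 1 & 0 & * & 0\\ 1 & 0 & * & 1\\ 1 & 1 & 1 &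 *\\ a & 1 & 0 & *\\ a' & 1 & 0 & *\end{bmatrix}$$ $$M_{411}=\begin{bmatrix}0 & 0 & 0 & *\\ 0 & * & 1 & 0\\ 0 & * & 1 & 1\\ 1 & 0 & * & d\\ 1 & 0 & * & d'\\ 1 & 1 & 1 & *\\ a & 1 & 0 & *\\ a' & 1 & 0 & *\end{bmatrix}$$ $$M_{412}=\begin{bmatrix}0 & 0 & 0 & *\\ 0 & * & 1 & 0\\ 0 & * & 1 & 1\\ 1 & 0 & * & d\\ 1 & 0 & * & d'\\ 1 & 1 & 1 & *\\ * & 1 & 0 & x\\ * & 1 & 0 & x'\end{bmatrix}$$ $$M_{413}=\begin{bmatrix}0 & 0 & 0 & *\\ 0 & 1 & 0 & 1\\ 0 & b & 1 & *\\ 0 & b' & 1 & *\\ 1 & 1 & 1 & 0\\ 1 & 1 & * & 1\\ 1 & 0 & c & *\\ 1 & 0 & c' & *\\ * & 1 & 0 & 0\end{bmatrix}$$ $$M_{414}=\begin{bmatrix}0 & 0 & 0 & *\\ 0 & 1 & 0 & 1\\ 0 & b & 1 & *\\ 0 & b' & 1 & *\\ 1 & 1 & 1 & 0\\ 1 & 1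 & * & 1\\ 1 & 0 & * & d\\ 1 & 0 & * & d'\\ * & 1 & 0 & 0\end{bmatrix}$$ $$M_{415}=\begin{bmatrix}0 & 0 & 0 & *\\ 0 & 1 & 0 & 1\\ 0 & * & 1 & d\\ 0 & * & 1 & d'\\ 1 & 1 & 1 & 0\\ 1 & 1 & * & 1\\ 1 & 0 & c & *\\ 1 & 0 & c' & *\\ * & 1 & 0 & 0\end{bmatrix}$$ $$M_{416}=\begin{bmatrix}0 & 0 & 0 & *\\ 0 & 1 & 0 & 1\\ 0 & * & 1 & d\\ 0 & * & 1 & d'\\ 1 & 1 & 1 & 0\\ 1 & 1 & * & 1\\ 1 & 0 & * & x\\ 1 & 0 & * & x'\\ * & 1 & 0 & 0\end{bmatrix}$$ $$M_{417}=\begin{bmatrix}0 & 0 & 0 & 0\\ 0 & * & 0 & 1\\ 0 & b & 1 & *\\ 0 & b' & 1 & *\\ 1 & 1 & 1 & 0\\ 1 & 1 & * & 1\\ 1 & 0 & c & *\\ 1 & 0 & c' & *\\ * & 1 & 0 & 0\end{bmatrix}$$ $$M_{418}=\begin{bmatrix}0 & 0 & 0 & 0\\ 0 & 0 & * & 1\\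 0 & 1 & * & d\\ 0 & 1 & * & d'\\ 1 & 1 & 1 & 0\\ 1 & * & 1 & 1\\ 1 & b & 0 & *\\ 1 & b' & 0 & *\\ * & 0 & 1 & 0\end{bmatrix}$$ $$M_{419}=\begin{bmatrix}0 & 0 & 0 & 0\\ 0 & * & 0 & 1\\ 0 & * & 1 & d\\ 0 & * & 1 & d'\\ 1 & 1 & 1 & 0\\ 1 & 1 & * & 1\\ 1 & 0 & * & x\\ 1 & 0 & * & x'\\ * & 1 & 0 & 0\end{bmatrix}$$ $$M_{420}=\begin{bmatrix}0 & 0 & 0 & 0\\ 0 & 0 & 1 & *\\ 0 & 1 & c & *\\ 0 & 1 & c' & *\\ 1 & 1 & 1 & 0\\ 1 & 1 & 0 & *\\ 1 & 0 & * & 0\\ 1 & * & 1 & 1\\ * & 0 & 0 & 1\end{bmatrix}$$ $$M_{421}=\begin{bmatrix}0 & 0 & 0 & 0\\ 0 & 0 & 1 & *\\ 0 & 1 & * & d\\ 0 & 1 & * & d'\\ 1 & 1 & 1 & 0\\ 1 & 1 & 0 & *\\ 1 & 0 & * & 0\\ 1 & * & 1 & 1\\ * & 0 & 0 & 1\end{bmatrix}$$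 $$M_{422}=\begin{bmatrix}0 & 0 & 0 & 0\\ 0 & 1 & 0 & d\\ 0 & * & 1 & d\\ 0 & 1 & * & d'\\ 0 & 0 & 1 & d'\\ 1 & 1 & c & *\\ 1 & 1 & c' & *\\ 1 & 0 & 1 & 1\\ 1 & 0 & * & 0\\ * & 0 & 0 & 1\end{bmatrix}$$ $$M_{423}=\begin{bmatrix}0 & 0 & 0 & 0\\ 0 & 1 & 0 & d\\ 0 & * & 1 & d\\ 0 & 1 & * & d'\\ 0 & 0 & 1 & d'\\ 1 & 1 & * & x\\ 1 & 1 & * & x'\\ 1 & 0 & 1 & 1\\ 1 & 0 & * & 0\\ * & 0 & 0 & 1\end{bmatrix}$$ $$M_{424}=\begin{bmatrix}0 & 0 & 0 & 0\\ 0 & b & 0 & 1\\ 0 & b & 1 & *\\ 0 & b' & 1 & 0\\ 0 & b' & * & 1\\ 1 & 1 & 0 & 1\\ 1 & 1 & 1 & *\\ 1 & 0 & d & *\\ 1 & 0 & d' & *\\ * & 1 & 0 & 0\end{bmatrix}$$ $$M_{425}=\begin{bmatrix}0 & 0 & 0 & 0\\ 0 & b & 0 & 1\\ 0 & b & 1 &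 *\\ 0 & b' & 1 & 0\\ 0 & b' & * & 1\\ 1 & 1 & 0 & 1\\ 1 & 1 & 1 & *\\ 1 & 0 & * & d\\ 1 & 0 & * & d'\\ * & 1 & 0 & 0\end{bmatrix}$$ $$M_{426}=\begin{bmatrix}0 & 0 & 0 & 0\\ 0 & 1 & 1 & 1\\ 0 & * & 1 & 0\\ 0 & 0 & * & 1\\ 1 & 1 & 1 & d\\ 1 & 0 & 0 & d'\\ 1 & * & 1 & d'\\ 1 & 0 & * & d\\ a & 1 & 0 & *\\ a' & 1 & 0 & *\end{bmatrix}$$ $$M_{427}=\begin{bmatrix}0 & 0 & 0 & 0\\ 0 & 1 & 1 & 1\\ 0 & * & 1 & 0\\ 0 & 0 & * & 1\\ 1 & 1 & 1 & d\\ 1 & 0 & 0 & d'\\ 1 & * & 1 & d'\\ 1 & 0 & * & d\\ * & 1 & 0 & x\\ * & 1 & 0 & x'\end{bmatrix}$$ $$M_{428}=\begin{bmatrix}0 & 0 & 0 & 0\\ 0 & * & 1 & 0\\ 0 & 0 & * & 1\\ 0 & 1 & 0 & *\\ 0 & 1 & 1 & 1\\ 1 & b & c & d\\ 1 & * & c'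 & d\\ 1 & b & * & d'\\ 1 & b' & c & *\\ 1 & b' & c' & d'\end{bmatrix}$$ $$M_{429}=\begin{bmatrix}0 & * & 1 & 0\\ 0 & 0 & * & 1\\ 0 & 1 & 0 & *\\ 1 & * & 0 & 1\\ 1 & 1 & * & 0\\ 1 & 0 & 1 & *\\ * & 0 & 0 & 0\\ * & 1 & 1 & 1\end{bmatrix}$$ $$M_{430}=\begin{bmatrix}0 & 0 & 0 & 0\\ 0 & * & 1 & 0\\ 0 & 0 & * & 1\\ 0 & 1 & 0 & *\\ 1 & 1 & 1 & 0\\ 1 & 0 & 1 & d\\ 1 & * & 0 & d\\ 1 & 0 & * & d'\\ 1 & 1 & 0 & d'\\ * & 1 & 1 & 1\end{bmatrix}$$ $$M_{431}=\begin{bmatrix}0 & 0 & 0 & 0\\ 0 & 1 & 0 & d\\ 0 & * & 1 & d\\ 0 & 1 & * & d'\\ 0 & 0 & 1 & d'\\ 1 & 0 & 1 & 1\\ 1 & 0 & c & 0\\ 1 & 1 & c & *\\ 1 & * & c' & 0\\ 1 & 1 & c' & 1\\ * & 0 & 0 & 1\end{bmatrix}$$ $$M_{432}=\begin{bmatrix}0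 & 0 & 0 & 0\\ 0 & 1 & 1 & d\\ 0 & 0 & * & 1\\ 0 & 1 & * & d'\\ 1 & 1 & 1 & 0\\ 1 & 0 & 0 & d\\ 1 & * & 0 & d'\\ 1 & * & 1 & 1\\ * & 0 & 1 & 0\\ * & 1 & 0 & d\end{bmatrix}$$ $$M_{433}=\begin{bmatrix}0 & 0 & 0 & 0\\ 0 & 0 & c & 1\\ 0 & 1 & 0 & d\\ 0 & * & 1 & 0\\ 0 & 1 & 1 & 1\\ 1 & 0 & c' & 0\\ 1 & 0 & c & d'\\ 1 & 1 & c' & d\\ 1 & * & c & d\\ 1 & 1 & 1 & d'\\ * & 0 & c' & 1\\ * & 1 & 0 & d'\end{bmatrix}$$ **Theorem.** For all values of the vector variables and of the stars: (i) the OPBs $M_{41},M_{42},\dots,M_{46}$ are locally distinguishable; (ii) an OPB given by one of $M_{47},M_{48},\dots,M_{433}$ is locally distinguishable if it is equivalent to a set of the form $\{|0\rangle\otimes M_0,\ |1\rangle\otimes M_1\}$, that is $\{|0\rangle\otimes\varphi:\varphi\in M_0\}\cup\{|1\rangle\otimes\varphi:\varphi\in M_1\}$, where each of the sets of three-qubit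 states $M_0,M_1$ is equivalent to an OPB given by $M_{32}$ or $M_{33}$ for some values of their symbols; (iii) an OPB given by one of $M_{47},M_{48},\dots,M_{433}$ is locally indistinguishable if it is not equivalent to any set of that form. -/

import Mathlib

namespace QubitOPB

/-! ## States, product structure, equivalence -/

/-- (Unnormalised) pure states of `n` parties, each with a local space `κ → ℂ`, i.e. the tensor
product `(ℂ^κ)^{⊗ n}` written in coordinates with respect to the computational basis. -/
abbrev MultiState (κ : Type) (n : ℕ) : Type := (Fin n → κ) → ℂ

/-- States of `n` qubits. -/
abbrev QState (n : ℕ) : Type := MultiState (Fin 2) n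

/-- Orthonormal bases of the single-qubit space `ℂ²`. -/
abbrev QubitBasis : Type := OrthonormalBasis (Fin 2) ℂ (EuclideanSpace ℂ (Fin 2))

/-- The product state `v 0 ⊗ v 1 ⊗ ⋯ ⊗ v (n-1)`. -/
def productState {n : ℕ} (v : Fin n → EuclideanSpace ℂ (Fin 2)) : QState n :=
  fun x => ∏ i, v i (x i)

/-- The `n`-qubit state `ψ` after the systems have been permuted by `σ`. -/
def permuteSystems {n : ℕ} (σ : Equiv.Perm (Fin n)) (ψ : QState n) : QState n :=
  fun x => ψ (fun i => x (σ i))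

/-- The action of the product unitary `U 0 ⊗ U 1 ⊗ ⋯ ⊗ U (n-1)`. -/
def applyProductUnitary {n : ℕ} (U : Fin n → Matrix.unitaryGroup (Fin 2) ℂ) (ψ : QState n) :
    QState n :=
  fun x => ∑ y : Fin n → Fin 2,
    (∏ i, (U i : Matrix (Fin 2) (Fin 2) ℂ) (x i) (y i)) * ψ y

/-- `φ` and `ψ` are proportional, with a nonzero factor. -/
def Proportional {n : ℕ} (φ ψ : QState n) : Prop := ∃ c : ℂ, c ≠ 0 ∧ φ = c • ψ

/-- Two sets of `n`-qubit states are equivalent if, after a permutation of the systems and a product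
unitary, they are the same set of states up to nonzero scalar factors. -/
def Equivalent {n : ℕ} (A B : Set (QState n)) : Prop :=
  ∃ (σ : Equiv.Perm (Fin n)) (U : Fin n → Matrix.unitaryGroup (Fin 2) ℂ),
    (∀ ψ ∈ A, ∃ φ ∈ B, Proportional (applyProductUnitary U (permuteSystems σ ψ)) φ) ∧
    (∀ φ ∈ B, ∃ ψ ∈ A, Proportional (applyProductUnitary U (permuteSystems σ ψ)) φ)

/-! ## Local operations and classical communication -/

/-- Party `p` applies the operator `K` to its local system. -/
def applyLocal {κ : Type} [Fintype κ] {n : ℕ} (p : Fin n) (K : Matrix κ κ ℂ)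
    (ψ : MultiState κ n) : MultiState κ n :=
  fun x => ∑ y : κ, K (x p) y * ψ (Function.update x p y)

/-- `LOCCIdentifies ψ`: there is an LOCC protocol (a finite tree of local measurements) which, given
one unknown member `ψ i` of the family, identifies the index `i` with certainty.
* The protocol may stop as soon as at most one member of the family is compatible with the outcomes
  obtained so far, i.e. has a nonzero (unnormalised) post-measurement state.
* Otherwise some party `p` performs a measurement with Kraus operators `K 0, …, K (m-1)`,
  `∑ k, (K k)† (K k) = 1`, broadcasts the outcome `k`, and the protocol continues in a way that may
  depend on `k` (and so on all earlier outcomes) with the post-measurement states. -/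
inductive LOCCIdentifies {κ : Type} [Fintype κ] [DecidableEq κ] {n : ℕ} {ι : Type} :
    (ι → MultiState κ n) → Prop
  | done (ψ : ι → MultiState κ n) (h : ∀ i j, ψ i ≠ 0 → ψ j ≠ 0 → i = j) : LOCCIdentifies ψ
  | measure (ψ : ι → MultiState κ n) (p : Fin n) (m : ℕ) (K : Fin m → Matrix κ κ ℂ)
      (complete : ∑ k, (K k).conjTranspose * K k = 1)
      (next : ∀ k, LOCCIdentifies (fun i => applyLocal p (K k) (ψ i))) : LOCCIdentifies ψ

/-- Each party adjoins a private ancilla of dimension `r + 1` in the state `|0⟩` to its qubit. -/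
def withAncillas {n : ℕ} (r : ℕ) (ψ : QState n) : MultiState (Fin 2 × Fin (r + 1)) n :=
  fun x => if ∀ i, (x i).2 = 0 then ψ (fun i => (x i).1) else 0

/-- A set of `n`-qubit states is locally distinguishable if its members are perfectly identified by
some LOCC protocol between the `n` parties, with local ancillas of any finite dimension. -/
def LocallyDistinguishable {n : ℕ} (A : Set (QState n)) : Prop :=
  ∃ r : ℕ, LOCCIdentifies (fun ψ : A => withAncillas r (ψ : QState n))

/-! ## Orthogonal product matrices -/

/-- The letters used as vector variables. -/
inductive Letter
  | a | b | c | d | e | x | y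

/-- Entries of an orthogonal product matrix: the computational basis vectors `0` and `1`, a vector
variable, its orthogonal partner (the primed variable), or a star. -/
inductive Entry
  | zero
  | one
  | var (v : Letter)
  | perp (v : Letter)
  | star

/-- An orthogonal product matrix with `n` columns. A row with a star stands for two rows, in which
the star is replaced by the two members of an orthonormal basis belonging to that row. -/
structure OPM (n : ℕ) where
  rows : ℕ
  entry : Matrix (Fin rows) (Fin n) Entry

/-- Values of the symbols in an orthogonal product matrix: an orthonormal basis (variable, primed
variable) for each letter, and an orthonormal basis for (the star in) each row. -/
structure Assignment where
  var : Letter → QubitBasis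
  star : ℕ → QubitBasis

/-- The qubit vector denoted by an entry in row `r`; `t` selects one of the two rows which a row with
a star abbreviates, and plays no role for the other entries. -/
noncomputable def Entry.vec (ν : Assignment) (r : ℕ) (t : Fin 2) :
    Entry → EuclideanSpace ℂ (Fin 2)
  | .zero => EuclideanSpace.basisFun (Fin 2) ℂ 0
  | .one => EuclideanSpace.basisFun (Fin 2) ℂ 1
  | .var v => ν.var v 0
  | .perp v => ν.var v 1
  | .star => ν.star r t

/-- The set of product states given by the rows of an orthogonal product matrix. -/
noncomputable def OPM.states {n : ℕ} (M : OPM n) (ν : Assignment) : Set (QState n) :=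
  {ψ | ∃ (r : Fin M.rows) (t : Fin 2), ψ = productState (fun j => (M.entry r j).vec ν r t)}

instance : Zero Entry := ⟨Entry.zero⟩

instance : One Entry := ⟨Entry.one⟩

/-- Short names for the symbols, so that the matrices below can be read as usual; `S` is the star. -/
abbrev Entry.S : Entry := .star

abbrev Entry.a : Entry := .var .a
abbrev Entry.a' : Entry := .perp .a
abbrev Entry.b : Entry := .var .b
abbrev Entry.b' : Entry := .perp .b
abbrev Entry.c : Entry := .var .c
abbrev Entry.c' : Entry := .perp .c
abbrev Entry.d : Entry := .var .d
abbrev Entry.d' : Entry := .perp .d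
abbrev Entry.e : Entry := .var .e
abbrev Entry.e' : Entry := .perp .e
abbrev Entry.x : Entry := .var .x
abbrev Entry.x' : Entry := .perp .x
abbrev Entry.y : Entry := .var .y
abbrev Entry.y' : Entry := .perp .y

section Matrices

open Entry

def M32 : OPM 3 := ⟨4, !![
    0, 0, S;
    0, 1, S;
    1, e, S;
    1, e', S]⟩

def M33 : OPM 3 := ⟨4, !![
    0, 0, S;
    0, 1, S;
    1, S, e;
    1, S, e']⟩

def M41 : OPM 4 := ⟨8, !![
    0, 0, 0, S;
    0, 0, 1, S;
    0, 1, c, S;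
    0, 1, c', S;
    1, b, x, S;
    1, b, x', S;
    1, b', y, S;
    1, b', y', S]⟩

def M42 : OPM 4 := ⟨8, !![
    0, 0, S, 0;
    0, 0, S, 1;
    0, 1, 0, S;
    0, 1, 1, S;
    1, b, c, S;
    1, b, c', S;
    1, b', x, S;
    1, b', x', S]⟩

def M43 : OPM 4 := ⟨8, !![
    0, 0, 0, S;
    0, 0, 1, S;
    0, 1, S, 0;
    0, 1, S, 1;
    1, b, S, d;
    1, b, S, d';
    1, b', c, S;
    1, b', c', S]⟩

def M44 : OPM 4 := ⟨8, !![
    0, 0, 0, S;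
    0, 0, 1, S;
    0, 1, c, S;
    0, 1, c', S;
    1, b, S, 0;
    1, b, S, 1;
    1, b', S, d;
    1, b', S, d']⟩

def M45 : OPM 4 := ⟨8, !![
    0, 0, S, 0;
    0, 0, S, 1;
    0, 1, c, S;
    0, 1, c', S;
    1, b, 0, S;
    1, b', 0, S;
    1, x, 1, S;
    1, x', 1, S]⟩

def M46 : OPM 4 := ⟨8, !![
    0, 0, S, 0;
    0, 0, S, 1;
    0, 1, S, d;
    0, 1, S, d';
    1, b, 0, S;
    1, b', 0, S;
    1, x, 1, S;
    1, x', 1, S]⟩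

def M47 : OPM 4 := ⟨9, !![
    0, 0, c, S;
    0, 0, c', S;
    0, 1, x, S;
    0, 1, x', S;
    1, b, 0, 0;
    1, S, 1, 0;
    1, b, S, 1;
    1, b', 0, S;
    1, b', 1, 1]⟩

def M48 : OPM 4 := ⟨9, !![
    0, 0, S, d;
    0, 0, S, d';
    0, 1, c, S;
    0, 1, c', S;
    1, S, 1, 0;
    1, b, 0, 0;
    1, b, S, 1;
    1, b', 0, S;
    1, b', 1, 1]⟩

def M49 : OPM 4 := ⟨8, !![
    0, 0, 0, S;
    0, b, 1, S;
    0, b', 1, S;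
    1, 0, c, S;
    1, 0, c', S;
    1, 1, 1, S;
    a, 1, 0, S;
    a', 1, 0, S]⟩

def M410 : OPM 4 := ⟨8, !![
    0, 0, 0, S;
    0, b, 1, S;
    0, b', 1, S;
    1, 0, S, 0;
    1, 0, S, 1;
    1, 1, 1, S;
    a, 1, 0, S;
    a', 1, 0, S]⟩

def M411 : OPM 4 := ⟨8, !![
    0, 0, 0, S;
    0, S, 1, 0;
    0, S, 1, 1;
    1, 0, S, d;
    1, 0, S, d';
    1, 1, 1, S;
    a, 1, 0, S;
    a', 1, 0, S]⟩

def M412 : OPM 4 := ⟨8, !![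
    0, 0, 0, S;
    0, S, 1, 0;
    0, S, 1, 1;
    1, 0, S, d;
    1, 0, S, d';
    1, 1, 1, S;
    S, 1, 0, x;
    S, 1, 0, x']⟩

def M413 : OPM 4 := ⟨9, !![
    0, 0, 0, S;
    0, 1, 0, 1;
    0, b, 1, S;
    0, b', 1, S;
    1, 1, 1, 0;
    1, 1, S, 1;
    1, 0, c, S;
    1, 0, c', S;
    S, 1, 0, 0]⟩

def M414 : OPM 4 := ⟨9, !![
    0, 0, 0, S;
    0, 1, 0, 1;
    0, b, 1, S;
    0, b', 1, S;
    1, 1, 1, 0;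
    1, 1, S, 1;
    1, 0, S, d;
    1, 0, S, d';
    S, 1, 0, 0]⟩

def M415 : OPM 4 := ⟨9, !![
    0, 0, 0, S;
    0, 1, 0, 1;
    0, S, 1, d;
    0, S, 1, d';
    1, 1, 1, 0;
    1, 1, S, 1;
    1, 0, c, S;
    1, 0, c', S;
    S, 1, 0, 0]⟩

def M416 : OPM 4 := ⟨9, !![
    0, 0, 0, S;
    0, 1, 0, 1;
    0, S, 1, d;
    0, S, 1, d';
    1, 1, 1, 0;
    1, 1, S, 1;
    1, 0, S, x;
    1, 0, S, x';
    S, 1, 0, 0]⟩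

def M417 : OPM 4 := ⟨9, !![
    0, 0, 0, 0;
    0, S, 0, 1;
    0, b, 1, S;
    0, b', 1, S;
    1, 1, 1, 0;
    1, 1, S, 1;
    1, 0, c, S;
    1, 0, c', S;
    S, 1, 0, 0]⟩

def M418 : OPM 4 := ⟨9, !![
    0, 0, 0, 0;
    0, 0, S, 1;
    0, 1, S, d;
    0, 1, S, d';
    1, 1, 1, 0;
    1, S, 1, 1;
    1, b, 0, S;
    1, b', 0, S;
    S, 0, 1, 0]⟩

def M419 : OPM 4 := ⟨9, !![
    0, 0, 0, 0;
    0, S, 0, 1;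
    0, S, 1, d;
    0, S, 1, d';
    1, 1, 1, 0;
    1, 1, S, 1;
    1, 0, S, x;
    1, 0, S, x';
    S, 1, 0, 0]⟩

def M420 : OPM 4 := ⟨9, !![
    0, 0, 0, 0;
    0, 0, 1, S;
    0, 1, c, S;
    0, 1, c', S;
    1, 1, 1, 0;
    1, 1, 0, S;
    1, 0, S, 0;
    1, S, 1, 1;
    S, 0, 0, 1]⟩

def M421 : OPM 4 := ⟨9, !![
    0, 0, 0, 0;
    0, 0, 1, S;
    0, 1, S, d;
    0, 1, S, d';
    1, 1, 1, 0;
    1, 1, 0, S;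
    1, 0, S, 0;
    1, S, 1, 1;
    S, 0, 0, 1]⟩

def M422 : OPM 4 := ⟨10, !![
    0, 0, 0, 0;
    0, 1, 0, d;
    0, S, 1, d;
    0, 1, S, d';
    0, 0, 1, d';
    1, 1, c, S;
    1, 1, c', S;
    1, 0, 1, 1;
    1, 0, S, 0;
    S, 0, 0, 1]⟩

def M423 : OPM 4 := ⟨10, !![
    0, 0, 0, 0;
    0, 1, 0, d;
    0, S, 1, d;
    0, 1, S, d';
    0, 0, 1, d';
    1, 1, S, x;
    1, 1, S, x';
    1, 0, 1, 1;
    1, 0, S, 0;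
    S, 0, 0, 1]⟩

def M424 : OPM 4 := ⟨10, !![
    0, 0, 0, 0;
    0, b, 0, 1;
    0, b, 1, S;
    0, b', 1, 0;
    0, b', S, 1;
    1, 1, 0, 1;
    1, 1, 1, S;
    1, 0, d, S;
    1, 0, d', S;
    S, 1, 0, 0]⟩

def M425 : OPM 4 := ⟨10, !![
    0, 0, 0, 0;
    0, b, 0, 1;
    0, b, 1, S;
    0, b', 1, 0;
    0, b', S, 1;
    1, 1, 0, 1;
    1, 1, 1, S;
    1, 0, S, d;
    1, 0, S, d';
    S, 1, 0, 0]⟩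

def M426 : OPM 4 := ⟨10, !![
    0, 0, 0, 0;
    0, 1, 1, 1;
    0, S, 1, 0;
    0, 0, S, 1;
    1, 1, 1, d;
    1, 0, 0, d';
    1, S, 1, d';
    1, 0, S, d;
    a, 1, 0, S;
    a', 1, 0, S]⟩

def M427 : OPM 4 := ⟨10, !![
    0, 0, 0, 0;
    0, 1, 1, 1;
    0, S, 1, 0;
    0, 0, S, 1;
    1, 1, 1, d;
    1, 0, 0, d';
    1, S, 1, d';
    1, 0, S, d;
    S, 1, 0, x;
    S, 1, 0, x']⟩

def M428 : OPM 4 := ⟨10, !![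
    0, 0, 0, 0;
    0, S, 1, 0;
    0, 0, S, 1;
    0, 1, 0, S;
    0, 1, 1, 1;
    1, b, c, d;
    1, S, c', d;
    1, b, S, d';
    1, b', c, S;
    1, b', c', d']⟩

def M429 : OPM 4 := ⟨8, !![
    0, S, 1, 0;
    0, 0, S, 1;
    0, 1, 0, S;
    1, S, 0, 1;
    1, 1, S, 0;
    1, 0, 1, S;
    S, 0, 0, 0;
    S, 1, 1, 1]⟩

def M430 : OPM 4 := ⟨10, !![
    0, 0, 0, 0;
    0, S, 1, 0;
    0, 0, S, 1;
    0, 1, 0, S;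
    1, 1, 1, 0;
    1, 0, 1, d;
    1, S, 0, d;
    1, 0, S, d';
    1, 1, 0, d';
    S, 1, 1, 1]⟩

def M431 : OPM 4 := ⟨11, !![
    0, 0, 0, 0;
    0, 1, 0, d;
    0, S, 1, d;
    0, 1, S, d';
    0, 0, 1, d';
    1, 0, 1, 1;
    1, 0, c, 0;
    1, 1, c, S;
    1, S, c', 0;
    1, 1, c', 1;
    S, 0, 0, 1]⟩

def M432 : OPM 4 := ⟨10, !![
    0, 0, 0, 0;
    0, 1, 1, d;
    0, 0, S, 1;
    0, 1, S, d';
    1, 1, 1, 0;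
    1, 0, 0, d;
    1, S, 0, d';
    1, S, 1, 1;
    S, 0, 1, 0;
    S, 1, 0, d]⟩

def M433 : OPM 4 := ⟨12, !![
    0, 0, 0, 0;
    0, 0, c, 1;
    0, 1, 0, d;
    0, S, 1, 0;
    0, 1, 1, 1;
    1, 0, c', 0;
    1, 0, c, d';
    1, 1, c', d;
    1, S, c, d;
    1, 1, 1, d';
    S, 0, c', 1;
    S, 1, 0, d']⟩

end Matrices

/-- The list `M_{41}, …, M_{46}`. -/
def firstSix : List (OPM 4) := [M41, M42, M43, M44, M45, M46]

/-- The list `M_{47}, …, M_{433}`. -/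
def remaining : List (OPM 4) :=
  [M47, M48, M49, M410, M411, M412, M413, M414, M415, M416, M417, M418, M419, M420, M421, M422,
    M423, M424, M425, M426, M427, M428, M429, M430, M431, M432, M433]

/-! ## Splitting along one qubit -/

/-- The set `{|k⟩ ⊗ φ : φ ∈ T}`. -/
def ketTensor {n : ℕ} (k : Fin 2) (T : Set (QState n)) : Set (QState (n + 1)) :=
  {ψ | ∃ φ ∈ T, ψ = fun x => if x 0 = k then φ (fun i => x i.succ) else 0}

/-- A set of three-qubit states that is equivalent to `M_{32}` or `M_{33}`, for some values of the
symbols in these matrices. -/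
def EquivalentToM32OrM33 (T : Set (QState 3)) : Prop :=
  ∃ ν : Assignment, Equivalent T (M32.states ν) ∨ Equivalent T (M33.states ν)

/-- Up to equivalence, the set is `{|0⟩ ⊗ M₀, |1⟩ ⊗ M₁}` with each of `M₀`, `M₁` equivalent to
`M_{32}` or `M_{33}`. -/
def Splits (A : Set (QState 4)) : Prop :=
  ∃ T₀ T₁ : Set (QState 3), EquivalentToM32OrM33 T₀ ∧ EquivalentToM32OrM33 T₁ ∧
    Equivalent A (ketTensor 0 T₀ ∪ ketTensor 1 T₁)

end QubitOPB

/-!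
A locally distinguishable orthogonal product basis of four qubits is a decision tree of local
projective measurements, and such a tree is the same thing as the splitting in the theorem.

*From a protocol to a tree.* If an LOCC protocol identifies product states with certainty, the states
are orthogonal after every step (`LOCCIdentifies.orthogonal`). Suppose the states form a basis of a
space that is invariant under operators on system `p`, and that party `p` applies a Kraus operator
`K`. Since `G = K†K` keeps the states orthogonal, each of them is an eigenvector of `G` acting on
system `p`, and so is its factor in column `p` (`FreeAt.eigenvector`). If `G` is scalar, the step is
uninformative and only changes the states by a local isometry up to a factor; otherwise the vectors
in column `p` lie on the two lines of the eigenbasis of `G`. Hence the first informative step of the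
protocol exhibits a column with two orthogonal directions only (`LOCCIdentifies.split`). In each half
of the family that column is constant, the other columns keep the invariance property
(`FreeAt.restrict`), and the same protocol still identifies the half; so induction gives a tree over
all columns (`tree_of_locc`).

*From a tree to a protocol.* The measurements of a tree do not disturb the states, so they are an LOCC
protocol without ancillas (`Tree.locc`). The matrices `M32`, `M33` and `M41` to `M46` are trees by
inspection, and trees are preserved by equivalences and by adjoining a computational basis vector.

*Trees and splittings.* The root of a four-qubit tree is the splitting qubit. The branches are
three-qubit trees, and such a tree is equivalent to `M32` or to `M33` according as its two subtrees
measure the same system next or different ones (`Tree.equivalentToM32OrM33`).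

That `M47` to `M433` denote orthogonal product bases for all values of their symbols is a finite check
on the symbols: there are sixteen states, and any two are formally orthogonal in some column.
-/

namespace QubitOPB

open Matrix

/-! ### Product vectors and local operators -/

section Tprod

/-- The product vector `a 0 ⊗ a 1 ⊗ ⋯` for local spaces of arbitrary dimension. -/
def tprod {κ : Type} {n : ℕ} (a : Fin n → κ → ℂ) : MultiState κ n := fun x => ∏ i, a i (x i)

lemma productState_eq_tprod {n : ℕ} (v : Fin n → EuclideanSpace ℂ (Fin 2)) :
    productState v = tprod (fun i => (v i).ofLp) := rfl

variable {κ : Type} {n : ℕ}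

lemma tprod_apply_erase (a : Fin n → κ → ℂ) (p : Fin n) (x : Fin n → κ) :
    tprod a x = a p (x p) * ∏ i ∈ Finset.univ.erase p, a i (x i) :=
  (Finset.mul_prod_erase _ _ (Finset.mem_univ p)).symm

lemma tprod_ne_zero {a : Fin n → κ → ℂ} (h : ∀ i, a i ≠ 0) : tprod a ≠ 0 := by
  choose x hx using fun i => Function.ne_iff.1 (h i)
  exact Function.ne_iff.2 ⟨x, Finset.prod_ne_zero_iff.2 fun i _ => hx i⟩

lemma tprod_update_smul (a : Fin n → κ → ℂ) (p : Fin n) (c : ℂ) (u : κ → ℂ) :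
    tprod (Function.update a p (c • u)) = c • tprod (Function.update a p u) := by
  ext x
  simp only [Pi.smul_apply, smul_eq_mul, tprod_apply_erase _ p, Function.update_self, mul_assoc]
  congr 2
  exact Finset.prod_congr rfl fun i hi => by simp [Finset.ne_of_mem_erase hi]

lemma tprod_update_zero (a : Fin n → κ → ℂ) (p : Fin n) : tprod (Function.update a p 0) = 0 := by
  simpa using tprod_update_smul a p 0 0

/-- If changing one factor of a nonzero product vector multiplies the vector by `c`, the factor was
multiplied by `c`. -/
lemma eq_smul_of_tprod_update {a : Fin n → κ → ℂ} (ha : ∀ i, a i ≠ 0) {p : Fin n} {u : κ → ℂ}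
    {c : ℂ} (h : tprod (Function.update a p u) = c • tprod a) : u = c • a p := by
  choose x hx using fun i => Function.ne_iff.1 (ha i)
  ext z
  have h1 := congrFun h (Function.update x p z)
  simp only [Pi.smul_apply, smul_eq_mul, tprod_apply_erase _ p, Function.update_self] at h1
  have h2 : ∀ b : Fin n → κ → ℂ, (∀ i ≠ p, b i = a i) →
      ∏ i ∈ Finset.univ.erase p, b i (Function.update x p z i)
        = ∏ i ∈ Finset.univ.erase p, a i (x i) := fun b hb =>
    Finset.prod_congr rfl fun i hi => by
      rw [hb i (Finset.ne_of_mem_erase hi), Function.update_of_ne (Finset.ne_of_mem_erase hi)]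
  rw [h2 _ (fun i hi => Function.update_of_ne hi _ _), h2 a (fun _ _ => rfl), ← mul_assoc] at h1
  exact mul_right_cancel₀ (Finset.prod_ne_zero_iff.2 fun i _ => hx i) h1

variable [Fintype κ]

lemma star_tprod_dotProduct (a b : Fin n → κ → ℂ) :
    star (tprod a) ⬝ᵥ tprod b = ∏ i, star (a i) ⬝ᵥ b i := by
  simp only [dotProduct, Finset.prod_univ_sum, Fintype.piFinset_univ]
  refine Finset.sum_congr rfl fun x _ => ?_
  simp [tprod, Finset.prod_mul_distrib]

lemma star_tprod_dotProduct_erase (a b : Fin n → κ → ℂ) (p : Fin n) :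
    star (tprod a) ⬝ᵥ tprod b
      = (star (a p) ⬝ᵥ b p) * ∏ i ∈ Finset.univ.erase p, star (a i) ⬝ᵥ b i := by
  rw [star_tprod_dotProduct]
  exact (Finset.mul_prod_erase _ _ (Finset.mem_univ p)).symm

lemma applyLocal_tprod (p : Fin n) (K : Matrix κ κ ℂ) (a : Fin n → κ → ℂ) :
    applyLocal p K (tprod a) = tprod (Function.update a p (K *ᵥ a p)) := by
  ext x
  simp only [applyLocal, tprod_apply_erase _ p, Function.update_self, mulVec, dotProduct,
    Finset.sum_mul, mul_assoc]
  refine Finset.sum_congr rfl fun y _ => ?_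
  congr 2
  exact Finset.prod_congr rfl fun i hi => by simp [Finset.ne_of_mem_erase hi]

/-- `applyLocal p K` as a linear map. -/
def applyLocalLin (p : Fin n) (K : Matrix κ κ ℂ) : MultiState κ n →ₗ[ℂ] MultiState κ n where
  toFun := applyLocal p K
  map_add' φ ψ := by
    ext x; simp [applyLocal, mul_add, Finset.sum_add_distrib]
  map_smul' c ψ := by
    ext x; simp [applyLocal, Finset.mul_sum, mul_left_comm]

@[simp] lemma applyLocalLin_apply (p : Fin n) (K : Matrix κ κ ℂ) (ψ : MultiState κ n) :
    applyLocalLin p K ψ = applyLocal p K ψ := rfl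

lemma star_mulVec_dotProduct_mulVec {α β : Type} [Fintype α] [Fintype β] (A : Matrix α β ℂ)
    (x y : β → ℂ) : star (A *ᵥ x) ⬝ᵥ (A *ᵥ y) = star x ⬝ᵥ ((Aᴴ * A) *ᵥ y) := by
  rw [star_mulVec, ← dotProduct_mulVec, mulVec_mulVec]

open ComplexOrder in
lemma star_dotProduct_self_ne_zero {u : κ → ℂ} (hu : u ≠ 0) : star u ⬝ᵥ u ≠ 0 := fun h =>
  hu (dotProduct_star_self_eq_zero.1 h)

end Tprod

/-! ### Orthogonality of states identified by LOCC -/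

section Orthogonality

variable {κ : Type} [Fintype κ] [DecidableEq κ] {n : ℕ} {ι : Type}

/-- A complete measurement preserves inner products on average. -/
lemma sum_star_mulVec_dotProduct {m : ℕ} {K : Fin m → Matrix κ κ ℂ}
    (hK : ∑ k, (K k)ᴴ * K k = 1) (x y : κ → ℂ) :
    ∑ k, star (K k *ᵥ x) ⬝ᵥ (K k *ᵥ y) = star x ⬝ᵥ y := by
  simp only [star_mulVec_dotProduct_mulVec]
  rw [← dotProduct_sum, ← sum_mulVec, hK, one_mulVec]

/-- Product states that an LOCC protocol identifies with certainty are pairwise orthogonal. -/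
lemma LOCCIdentifies.orthogonal {ψ : ι → MultiState κ n} (h : LOCCIdentifies ψ) :
    ∀ a : ι → Fin n → κ → ℂ, (ψ = fun i => tprod (a i)) →
      ∀ i j, i ≠ j → star (tprod (a i)) ⬝ᵥ tprod (a j) = 0 := by
  induction h with
  | done ψ h =>
    rintro a rfl i j hij
    by_contra h0
    refine hij (h i j ?_ ?_) <;> · intro h1; simp [h1] at h0
  | measure ψ p m K complete next ih =>
    rintro a rfl i j hij
    have h1 : ∀ k, (star (K k *ᵥ a i p) ⬝ᵥ (K k *ᵥ a j p))
        * ∏ q ∈ Finset.univ.erase p, star (a i q) ⬝ᵥ a j q = 0 := by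
      intro k
      have := ih k (fun i => Function.update (a i) p (K k *ᵥ a i p))
        (funext fun i => applyLocal_tprod p (K k) (a i)) i j hij
      rw [star_tprod_dotProduct_erase _ _ p, Function.update_self, Function.update_self] at this
      rw [← this]
      congr 1
      exact Finset.prod_congr rfl fun q hq => by simp [Finset.ne_of_mem_erase hq]
    rw [star_tprod_dotProduct_erase _ _ p, ← sum_star_mulVec_dotProduct complete, Finset.sum_mul]
    exact Finset.sum_eq_zero fun k _ => h1 k

/-- A protocol for a family also identifies every family that is obtained from it by an injective
reindexing and scalar factors (zero factors allowed). -/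
lemma LOCCIdentifies.pullback {ι' : Type} {ψ : ι → MultiState κ n} (h : LOCCIdentifies ψ) :
    ∀ {φ : ι' → MultiState κ n} (f : ι' → ι), Function.Injective f →
      (∀ i, ∃ c : ℂ, φ i = c • ψ (f i)) → LOCCIdentifies φ := by
  induction h with
  | done ψ h =>
    intro φ f hf hc
    refine .done _ fun i j hi hj => hf (h _ _ ?_ ?_)
    · rintro h0; obtain ⟨c, hc⟩ := hc i; simp [hc, h0] at hi
    · rintro h0; obtain ⟨c, hc⟩ := hc j; simp [hc, h0] at hj
  | measure ψ p m K complete next ih =>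
    intro φ f hf hc
    refine .measure _ p m K complete fun k => ih k f hf fun i => ?_
    obtain ⟨c, hc⟩ := hc i
    exact ⟨c, by rw [hc]; exact (applyLocalLin p (K k)).map_smul c (ψ (f i))⟩

end Orthogonality

/-! ### The first informative measurement -/

section Splitting

variable {n : ℕ} {ι : Type}

/-- In column `p`, all the vectors of the family are multiples of one vector. -/
def ConstAt (v : ι → Fin n → EuclideanSpace ℂ (Fin 2)) (p : Fin n) : Prop :=
  ∃ u : EuclideanSpace ℂ (Fin 2), ∀ i, ∃ c : ℂ, v i p = c • u

/-- The span of the product states of the family is invariant under all operators on system `p`. -/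
def FreeAt (v : ι → Fin n → EuclideanSpace ℂ (Fin 2)) (p : Fin n) : Prop :=
  ∀ (G : Matrix (Fin 2) (Fin 2) ℂ) (i : ι), applyLocal p G (productState (v i)) ∈
    Submodule.span ℂ (Set.range fun i => productState (v i))

/-- If the states form an orthogonal basis of a space invariant under operators on system `p`, and a
local operator `G` preserves their orthogonality, then all the vectors in column `p` are
eigenvectors of `G`. -/
lemma FreeAt.eigenvector {v : ι → Fin n → EuclideanSpace ℂ (Fin 2)} {p : Fin n} (hp : FreeAt v p)
    (nz : ∀ i q, v i q ≠ 0)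
    (orth : ∀ i j, i ≠ j → star (productState (v i)) ⬝ᵥ productState (v j) = 0)
    {G : Matrix (Fin 2) (Fin 2) ℂ}
    (hG : ∀ i j, i ≠ j →
      star (productState (v i)) ⬝ᵥ applyLocal p G (productState (v j)) = 0) (j : ι) :
    ∃ c : ℂ, G *ᵥ (v j p).ofLp = c • (v j p).ofLp := by
  have nz' : ∀ i q, (v i q).ofLp ≠ 0 := fun i q h => nz i q (by ext z; simp [h])
  set ψ : ι → QState n := fun i => productState (v i) with hψ
  have hψ0 : star (ψ j) ⬝ᵥ ψ j ≠ 0 := star_dotProduct_self_ne_zero (tprod_ne_zero (nz' j))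
  set Y := applyLocal p G (ψ j) with hY
  set c : ℂ := (star (ψ j) ⬝ᵥ Y) / (star (ψ j) ⬝ᵥ ψ j) with hc
  -- `Z` is the component of `Y` orthogonal to `ψ j`; it lies in the span and is orthogonal to it.
  set Z : QState n := Y - c • ψ j with hZ
  have hZspan : Z ∈ Submodule.span ℂ (Set.range ψ) :=
    Submodule.sub_mem _ (hp G j) (Submodule.smul_mem _ _ (Submodule.subset_span ⟨j, rfl⟩))
  have hZo : ∀ i, star (ψ i) ⬝ᵥ Z = 0 := by
    intro i
    rw [hZ, dotProduct_sub, dotProduct_smul, smul_eq_mul]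
    by_cases hij : i = j
    · subst hij
      rw [hc, div_mul_cancel₀ _ hψ0, sub_self]
    · rw [hG i j hij, orth i j hij, mul_zero, sub_zero]
  have hZall : ∀ w ∈ Submodule.span ℂ (Set.range ψ), star w ⬝ᵥ Z = 0 := by
    intro w hw
    induction hw using Submodule.span_induction with
    | mem x hx => obtain ⟨i, rfl⟩ := hx; exact hZo i
    | zero => simp
    | add x y _ _ hx hy => rw [star_add, add_dotProduct, hx, hy, add_zero]
    | smul a x _ hx => rw [star_smul, smul_dotProduct, hx, smul_zero]
  have hZ0 : Z = 0 := by
    by_contra h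
    exact star_dotProduct_self_ne_zero h (hZall Z hZspan)
  refine ⟨c, eq_smul_of_tprod_update (a := fun q => (v j q).ofLp) (nz' j) (p := p) ?_⟩
  rw [← applyLocal_tprod]
  exact sub_eq_zero.1 hZ0

/-- A Hermitian operator on a qubit is scalar, or its eigenvectors lie on the two lines of an
orthonormal basis. -/
lemma hermitian_scalar_or_basis {G : Matrix (Fin 2) (Fin 2) ℂ} (hG : G.IsHermitian) :
    (∃ γ : ℂ, G = γ • (1 : Matrix (Fin 2) (Fin 2) ℂ)) ∨
      ∃ B : QubitBasis, ∀ w : EuclideanSpace ℂ (Fin 2),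
        (∃ c : ℂ, G *ᵥ w.ofLp = c • w.ofLp) → ∃ (k : Fin 2) (c : ℂ), w = c • B k := by
  set B : QubitBasis := hG.eigenvectorBasis with hB
  have hBv : ∀ k, G *ᵥ (B k).ofLp = (hG.eigenvalues k : ℂ) • (B k).ofLp := fun k => by
    have := hG.mulVec_eigenvectorBasis k
    simpa using this
  have hexp : ∀ w : EuclideanSpace ℂ (Fin 2),
      w.ofLp = (B.repr w 0) • (B 0).ofLp + (B.repr w 1) • (B 1).ofLp := fun w => by
    conv_lhs => rw [← B.sum_repr w, Fin.sum_univ_two]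
    rfl
  by_cases heq : hG.eigenvalues 0 = hG.eigenvalues 1
  · left
    refine ⟨hG.eigenvalues 0, Matrix.ext_of_mulVec_single fun i => ?_⟩
    have h1 := hexp (WithLp.toLp 2 (Pi.single i 1))
    simp only at h1
    rw [h1, mulVec_add, mulVec_smul, mulVec_smul, hBv, hBv, ← heq, smul_mulVec, one_mulVec,
      smul_add, smul_comm, smul_comm (B.repr _ 1)]
  · right
    refine ⟨B, fun w ⟨c, hc⟩ => ?_⟩
    have hlin : B.repr w 0 * (hG.eigenvalues 0 - c) = 0 ∧
        B.repr w 1 * (hG.eigenvalues 1 - c) = 0 := by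
      have h2 : (B.repr w 0 * (hG.eigenvalues 0 - c)) • B 0
          + (B.repr w 1 * (hG.eigenvalues 1 - c)) • B 1 = 0 := by
        rw [hexp w, mulVec_add, mulVec_smul, mulVec_smul, hBv, hBv] at hc
        ext z
        have := congrFun hc z
        simp only [Pi.add_apply, Pi.smul_apply, smul_eq_mul] at this
        simp only [PiLp.add_apply, PiLp.smul_apply, smul_eq_mul, PiLp.zero_apply]
        linear_combination this
      have h3 := Fintype.linearIndependent_iff.1 B.orthonormal.linearIndependent
        ![B.repr w 0 * (hG.eigenvalues 0 - c), B.repr w 1 * (hG.eigenvalues 1 - c)]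
        (by simpa [Fin.sum_univ_two] using h2)
      exact ⟨h3 0, h3 1⟩
    have hsum := B.sum_repr w
    rw [Fin.sum_univ_two] at hsum
    rcases mul_eq_zero.1 hlin.1 with h0 | h0
    · exact ⟨1, B.repr w 1, by rw [← hsum, h0]; simp⟩
    · rcases mul_eq_zero.1 hlin.2 with h1 | h1
      · exact ⟨0, B.repr w 0, by rw [← hsum, h1]; simp⟩
      · exact absurd (Complex.ofReal_injective
          ((sub_eq_zero.1 h0).trans (sub_eq_zero.1 h1).symm)) heq

/-- If an LOCC protocol identifies a family of orthogonal product states each of whose columns is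
constant or free, then the family has at most one member or a free column holds only two directions,
which are orthogonal. Local operators `V q` that preserve the inner products in column `q` up to a
factor may have been applied already: they account for the ancillas and for the earlier,
uninformative steps of the protocol. -/
theorem LOCCIdentifies.split {κ : Type} [Fintype κ] [DecidableEq κ]
    {v : ι → Fin n → EuclideanSpace ℂ (Fin 2)} (nz : ∀ i q, v i q ≠ 0)
    (orth : ∀ i j, i ≠ j → star (productState (v i)) ⬝ᵥ productState (v j) = 0)
    (hcf : ∀ p, ConstAt v p ∨ FreeAt v p) {ψ : ι → MultiState κ n} (hl : LOCCIdentifies ψ) :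
    ∀ V : Fin n → Matrix κ (Fin 2) ℂ,
      (∀ q, ∃ μ : ℂ, μ ≠ 0 ∧ ∀ i j, star (V q *ᵥ (v i q).ofLp) ⬝ᵥ (V q *ᵥ (v j q).ofLp)
        = μ * (star (v i q).ofLp ⬝ᵥ (v j q).ofLp)) →
      (ψ = fun i => tprod fun q => V q *ᵥ (v i q).ofLp) →
      Subsingleton ι ∨
        ∃ p, FreeAt v p ∧ ∃ B : QubitBasis, ∀ i, ∃ (k : Fin 2) (c : ℂ), v i p = c • B k := by
  have nz' : ∀ i q, (v i q).ofLp ≠ 0 := fun i q h => nz i q (by ext z; simp [h])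
  have nn : ∀ i q, star (v i q).ofLp ⬝ᵥ (v i q).ofLp ≠ 0 := fun i q =>
    star_dotProduct_self_ne_zero (nz' i q)
  induction hl with
  | done ψ h =>
    rintro V hV rfl
    refine .inl ⟨fun i j => h i j ?_ ?_⟩ <;>
    · refine tprod_ne_zero fun q h0 => ?_
      obtain ⟨μ, hμ, hq⟩ := hV q
      first
      | exact mul_ne_zero hμ (nn i q) (by rw [← hq, h0]; simp)
      | exact mul_ne_zero hμ (nn j q) (by rw [← hq, h0]; simp)
  | measure ψ p m K complete next ih =>
    rintro V hV rfl
    by_cases hsub : Subsingleton ι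
    · exact .inl hsub
    obtain ⟨i₀⟩ : Nonempty ι := by
      by_contra h
      rw [not_nonempty_iff] at h
      exact hsub inferInstance
    set V' : Fin m → Fin n → Matrix κ (Fin 2) ℂ := fun k => Function.update V p (K k * V p)
    have hfam : ∀ k, (fun i => applyLocal p (K k) (tprod fun q => V q *ᵥ (v i q).ofLp))
        = fun i => tprod fun q => V' k q *ᵥ (v i q).ofLp := by
      intro k
      funext i
      rw [applyLocal_tprod]
      congr 1
      funext q
      by_cases hq : q = p
      · subst hq; simp [V', mulVec_mulVec]
      · simp [V', hq]
    set G : Fin m → Matrix (Fin 2) (Fin 2) ℂ := fun k => (K k * V p)ᴴ * (K k * V p)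
    by_cases hscal : ∀ k, ∃ γ : ℂ, ∀ i j, star (v i p).ofLp ⬝ᵥ (G k *ᵥ (v j p).ofLp)
        = γ * (star (v i p).ofLp ⬝ᵥ (v j p).ofLp)
    · -- No outcome is informative; follow one that has nonzero probability.
      choose γ hγ using hscal
      obtain ⟨μ, hμ, hp⟩ := hV p
      have hsum : (∑ k, γ k) = μ := by
        refine mul_right_cancel₀ (nn i₀ p) ?_
        rw [← hp, ← sum_star_mulVec_dotProduct complete, Finset.sum_mul]
        refine Finset.sum_congr rfl fun k _ => ?_
        rw [← hγ, ← star_mulVec_dotProduct_mulVec, mulVec_mulVec]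
      obtain ⟨k, -, hk⟩ := Finset.exists_ne_zero_of_sum_ne_zero (hsum ▸ hμ)
      refine ih k (V' k) (fun q => ?_) (hfam k)
      by_cases hq : q = p
      · subst hq
        refine ⟨γ k, hk, fun i j => ?_⟩
        simp only [V', Function.update_self]
        rw [star_mulVec_dotProduct_mulVec, hγ]
      · simpa [V', hq] using hV q
    · push Not at hscal
      obtain ⟨k, hk⟩ := hscal
      rcases hcf p with ⟨u, hu⟩ | hfree
      · -- In a constant column every operator acts as a scalar.
        exfalso
        choose a ha using hu
        have hu0 : u.ofLp ≠ 0 := fun h => nz' i₀ p (by rw [ha]; simp [h])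
        obtain ⟨i, j, hij⟩ := hk ((star u.ofLp ⬝ᵥ (G k *ᵥ u.ofLp)) / (star u.ofLp ⬝ᵥ u.ofLp))
        apply hij
        have h0 := star_dotProduct_self_ne_zero hu0
        simp only [ha, WithLp.ofLp_smul, mulVec_smul, star_smul, smul_dotProduct, dotProduct_smul,
          smul_eq_mul]
        field_simp
      · have hG : (G k).IsHermitian := isHermitian_conjTranspose_mul_self _
        have heig := hfree.eigenvector nz orth (G := G k) (fun i j hij => ?_)
        · rcases hermitian_scalar_or_basis hG with ⟨γ, hγ⟩ | ⟨B, hB⟩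
          · obtain ⟨i, j, hij⟩ := hk γ
            exact absurd (by rw [hγ, smul_mulVec, one_mulVec, dotProduct_smul, smul_eq_mul]) hij
          · exact .inr ⟨p, hfree, B, fun i => hB _ (heig i)⟩
        · have h1 := (next k).orthogonal _ (hfam k) i j hij
          rw [star_tprod_dotProduct_erase _ _ p] at h1
          simp only [productState_eq_tprod]
          rw [applyLocal_tprod, star_tprod_dotProduct_erase _ _ p, Function.update_self]
          choose μ hμ hV using hV
          have h2 : ∏ q ∈ Finset.univ.erase p,
                star (V' k q *ᵥ (v i q).ofLp) ⬝ᵥ (V' k q *ᵥ (v j q).ofLp)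
              = (∏ q ∈ Finset.univ.erase p, μ q)
                * ∏ q ∈ Finset.univ.erase p, star (v i q).ofLp ⬝ᵥ (v j q).ofLp := by
            rw [← Finset.prod_mul_distrib]
            refine Finset.prod_congr rfl fun q hq => ?_
            rw [← hV q i j]
            simp [V', Finset.ne_of_mem_erase hq]
          have h3 : ∏ q ∈ Finset.univ.erase p, star (v i q).ofLp ⬝ᵥ
                (Function.update (fun q => (v j q).ofLp) p (G k *ᵥ (v j p).ofLp) q)
              = ∏ q ∈ Finset.univ.erase p, star (v i q).ofLp ⬝ᵥ (v j q).ofLp :=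
            Finset.prod_congr rfl fun q hq => by simp [Finset.ne_of_mem_erase hq]
          rw [h3]
          simp only [V', Function.update_self] at h1
          rw [star_mulVec_dotProduct_mulVec] at h1
          rw [h2] at h1
          rcases mul_eq_zero.1 h1 with h4 | h4
          · exact mul_eq_zero_of_left h4 _
          · rcases mul_eq_zero.1 h4 with h5 | h5
            · exact absurd h5 (Finset.prod_ne_zero_iff.2 fun q _ => hμ q)
            · exact mul_eq_zero_of_right _ h5

end Splitting

/-! ### From LOCC protocols to trees -/

section LOCCToTree

/-- `Tree v C s`: the product states `v i`, `i ∈ s`, are told apart by measuring the systems in `C`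
one after the other in orthonormal bases, where the next system and its basis may depend on the
earlier outcomes and no measurement disturbs a state that is still possible. Each leaf of the tree
holds exactly one state. -/
inductive Tree {n : ℕ} {ι : Type} (v : ι → Fin n → EuclideanSpace ℂ (Fin 2)) :
    Finset (Fin n) → Set ι → Prop
  | leaf (i : ι) : Tree v ∅ {i}
  | node (C : Finset (Fin n)) (p : Fin n) (hp : p ∈ C) (B : QubitBasis) (t : Fin 2 → Set ι)
      (hB : ∀ k, ∀ i ∈ t k, ∃ c : ℂ, v i p = c • B k) (next : ∀ k, Tree v (C.erase p) (t k)) :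
      Tree v C (⋃ k, t k)

variable {n : ℕ} {ι : Type}

lemma ofLp_ne_zero {w : EuclideanSpace ℂ (Fin 2)} (h : w ≠ 0) : w.ofLp ≠ 0 := fun h0 =>
  h (by ext z; simp [h0])

lemma QubitBasis.star_dotProduct (B : QubitBasis) (k l : Fin 2) :
    star (B k).ofLp ⬝ᵥ (B l).ofLp = if k = l then 1 else 0 := by
  rw [dotProduct_comm, ← EuclideanSpace.inner_eq_star_dotProduct]
  exact orthonormal_iff_ite.1 B.orthonormal k l

/-- The operator `|u⟩⟨w|`. -/
def ketBra (u w : EuclideanSpace ℂ (Fin 2)) : Matrix (Fin 2) (Fin 2) ℂ :=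
  vecMulVec u.ofLp (star w.ofLp)

lemma ketBra_mulVec (u w : EuclideanSpace ℂ (Fin 2)) (x : Fin 2 → ℂ) :
    ketBra u w *ᵥ x = (star w.ofLp ⬝ᵥ x) • u.ofLp := by
  rw [ketBra, vecMulVec_mulVec]
  ext z
  simp [mul_comm]

lemma ketBra_self_mulVec (B : QubitBasis) (k : Fin 2) (c : ℂ) :
    ketBra (B k) (B k) *ᵥ (c • B k).ofLp = (c • B k).ofLp := by
  rw [ketBra_mulVec, WithLp.ofLp_smul, dotProduct_smul, QubitBasis.star_dotProduct, if_pos rfl,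
    smul_eq_mul, mul_one]

lemma ketBra_self_mulVec_of_ne (B : QubitBasis) {k l : Fin 2} (h : k ≠ l) (c : ℂ) :
    ketBra (B k) (B k) *ᵥ (c • B l).ofLp = 0 := by
  rw [ketBra_mulVec, WithLp.ofLp_smul, dotProduct_smul, QubitBasis.star_dotProduct, if_neg h,
    smul_zero, zero_smul]

/-- A basis one of whose members is proportional to a given vector. -/
lemma exists_basis_smul (u : EuclideanSpace ℂ (Fin 2)) :
    ∃ (B : QubitBasis) (c : ℂ), u = c • B 0 := by
  by_cases hu : u = 0
  · exact ⟨EuclideanSpace.basisFun _ _, 0, by simp [hu]⟩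
  have hn : ‖u‖ ≠ 0 := norm_ne_zero_iff.2 hu
  have horth : Orthonormal ℂ (({0} : Set (Fin 2)).domRestrict
      (fun _ : Fin 2 => ((‖u‖ : ℂ)⁻¹) • u)) := by
    rw [orthonormal_iff_ite]
    rintro ⟨i, hi⟩ ⟨j, hj⟩
    obtain rfl : i = 0 := hi
    obtain rfl : j = 0 := hj
    rw [if_pos rfl]
    change inner ℂ ((‖u‖ : ℂ)⁻¹ • u) ((‖u‖ : ℂ)⁻¹ • u) = 1
    rw [inner_self_eq_norm_sq_to_K, norm_smul]
    simp [hn]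
  obtain ⟨B, hB⟩ := horth.exists_orthonormalBasis_extension_of_card_eq (by simp)
  refine ⟨B, ‖u‖, ?_⟩
  rw [hB 0 rfl, smul_smul, mul_inv_cancel₀ (by exact_mod_cast hn), one_smul]

/-- A column that is free on a nonempty family is not constant. -/
lemma FreeAt.not_constAt {v : ι → Fin n → EuclideanSpace ℂ (Fin 2)} {p : Fin n}
    (hp : FreeAt v p) (nz : ∀ i q, v i q ≠ 0) (i : ι) : ¬ ConstAt v p := by
  rintro ⟨u, hu⟩
  obtain ⟨B, d, hd⟩ := exists_basis_smul u
  -- The projection onto `B 1` kills the whole span, but `|B 1⟩⟨B 0|` maps `v i p` to a nonzero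
  -- multiple of `B 1`.
  have hkill : ∀ φ ∈ Submodule.span ℂ (Set.range fun i => productState (v i)),
      applyLocal p (ketBra (B 1) (B 1)) φ = 0 := by
    intro φ hφ
    have : Submodule.span ℂ (Set.range fun i => productState (v i))
        ≤ LinearMap.ker (applyLocalLin p (ketBra (B 1) (B 1))) := by
      rw [Submodule.span_le]
      rintro _ ⟨j, rfl⟩
      obtain ⟨c, hc⟩ := hu j
      show applyLocal p _ _ = 0
      rw [productState_eq_tprod, applyLocal_tprod, hc, hd, smul_smul,
        ketBra_self_mulVec_of_ne B (by decide), tprod_update_zero]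
    exact this hφ
  have h1 := hkill _ (hp (ketBra (B 1) (B 0)) i)
  rw [productState_eq_tprod, applyLocal_tprod, applyLocal_tprod, Function.update_idem,
    Function.update_self, ketBra_mulVec, ketBra_mulVec] at h1
  refine tprod_ne_zero (fun q => ?_) h1
  by_cases hq : q = p
  · subst hq
    obtain ⟨c, hc⟩ := hu i
    have hne := nz i q
    rw [hc, hd] at hne
    have hc0 : c ≠ 0 := by rintro rfl; simp at hne
    have hd0 : d ≠ 0 := by rintro rfl; simp at hne
    rw [Function.update_self, hc, hd]
    simp only [WithLp.ofLp_smul, dotProduct_smul, QubitBasis.star_dotProduct, smul_eq_mul, if_true,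
      mul_one]
    exact smul_ne_zero (mul_ne_zero hc0 hd0) (ofLp_ne_zero (B.toBasis.ne_zero 1 ∘ by simp))
  · rw [Function.update_of_ne hq]
    exact ofLp_ne_zero (nz i q)

/-- After a free column has been split, the other free columns stay free on each part. -/
lemma FreeAt.restrict {v : ι → Fin n → EuclideanSpace ℂ (Fin 2)} {p q : Fin n} {s : Set ι}
    (hq : FreeAt (fun i : s => v i) q) (hpq : q ≠ p) {B : QubitBasis}
    (hB : ∀ i ∈ s, ∃ (k : Fin 2) (c : ℂ), v i p = c • B k) (k : Fin 2) :
    FreeAt (fun i : {i | i ∈ s ∧ ∃ c : ℂ, v i p = c • B k} => v i) q := by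
  set P := ketBra (B k) (B k) with hP
  have hPfix : ∀ i, (∃ c : ℂ, v i p = c • B k) →
      P *ᵥ (v i p).ofLp = (v i p).ofLp := by
    rintro i ⟨c, hc⟩
    rw [hP, hc, ketBra_self_mulVec]
  rintro G ⟨i, his, hi⟩
  have h1 := hq G ⟨i, his⟩
  have h2 := Submodule.mem_map_of_mem (f := applyLocalLin p P) h1
  have h3 : applyLocalLin p P (applyLocal q G (productState (v i)))
      = applyLocal q G (productState (v i)) := by
    simp only [applyLocalLin_apply, productState_eq_tprod, applyLocal_tprod]
    rw [Function.update_of_ne hpq.symm, hPfix i hi]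
    congr 1
    rw [Function.update_eq_self_iff, Function.update_of_ne hpq.symm]
  rw [h3, Submodule.map_span] at h2
  refine (Submodule.span_le.2 ?_) h2
  rintro _ ⟨_, ⟨⟨j, hj⟩, rfl⟩, rfl⟩
  by_cases hjk : ∃ c : ℂ, v j p = c • B k
  · refine Submodule.subset_span ⟨⟨j, hj, hjk⟩, ?_⟩
    simp only [applyLocalLin_apply, productState_eq_tprod, applyLocal_tprod]
    rw [hPfix j hjk, Function.update_eq_self]
  · obtain ⟨l, c, hc⟩ := hB j hj
    have hl : k ≠ l := by rintro rfl; exact hjk ⟨c, hc⟩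
    have h4 : applyLocalLin p P (productState (v j)) = 0 := by
      rw [applyLocalLin_apply, productState_eq_tprod, applyLocal_tprod, hP, hc,
        ketBra_self_mulVec_of_ne B hl, tprod_update_zero]
    change applyLocalLin p P (productState (v j)) ∈ _
    rw [h4]
    exact Submodule.zero_mem _

/-- In the computational basis the ancillas act as the isometry `|a⟩ ↦ |a⟩ ⊗ |0⟩` on each qubit. -/
lemma withAncillas_productState (r : ℕ) (w : Fin n → EuclideanSpace ℂ (Fin 2)) :
    withAncillas r (productState w)
      = tprod fun q (x : Fin 2 × Fin (r + 1)) => if x.2 = 0 then (w q).ofLp x.1 else 0 := by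
  ext x
  simp only [withAncillas, productState, tprod]
  split_ifs with h
  · exact Finset.prod_congr rfl fun i _ => by rw [if_pos (h i)]
  · push Not at h
    obtain ⟨i, hi⟩ := h
    exact (Finset.prod_eq_zero (Finset.mem_univ i) (if_neg hi)).symm

/-- Orthogonal product states that an LOCC protocol identifies form a tree over the free columns. -/
theorem tree_of_locc {v : ι → Fin n → EuclideanSpace ℂ (Fin 2)} {r : ℕ} (nz : ∀ i q, v i q ≠ 0)
    (orth : ∀ i j, i ≠ j → star (productState (v i)) ⬝ᵥ productState (v j) = 0)
    (hl : LOCCIdentifies fun i => withAncillas r (productState (v i))) (N : ℕ) :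
    ∀ (C : Finset (Fin n)) (s : Set ι), C.card = N → s.Nonempty →
      (∀ p ∈ C, FreeAt (fun i : s => v i) p) → (∀ p ∉ C, ConstAt (fun i : s => v i) p) →
      Tree v C s := by
  induction N with
  | zero =>
    rintro C s hC ⟨i, hi⟩ - hconst
    obtain rfl := Finset.card_eq_zero.1 hC
    suffices hs : s = {i} by rw [hs]; exact .leaf i
    refine Set.eq_singleton_iff_unique_mem.2 ⟨hi, fun j hj => ?_⟩
    by_contra hij
    have h0 := orth j i hij
    rw [productState_eq_tprod, productState_eq_tprod, star_tprod_dotProduct] at h0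
    obtain ⟨q, -, hq⟩ := Finset.prod_eq_zero_iff.1 h0
    obtain ⟨u, hu⟩ := hconst q (Finset.notMem_empty q)
    obtain ⟨a, ha⟩ := hu ⟨i, hi⟩
    obtain ⟨b, hb⟩ := hu ⟨j, hj⟩
    simp only at ha hb
    have hi0 := nz i q
    have hj0 := nz j q
    rw [ha] at hi0
    rw [hb] at hj0
    rw [ha, hb] at hq
    simp only [WithLp.ofLp_smul, star_smul, smul_dotProduct, dotProduct_smul, smul_eq_mul] at hq
    rcases mul_eq_zero.1 hq with h | h
    · exact (smul_ne_zero_iff.1 hi0).1 h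
    · rcases mul_eq_zero.1 h with h | h
      · exact (smul_ne_zero_iff.1 hj0).1 (star_eq_zero.1 h)
      · exact star_dotProduct_self_ne_zero (ofLp_ne_zero (smul_ne_zero_iff.1 hi0).2) h
  | succ N ih =>
    rintro C s hC ⟨i₀, hi₀⟩ hfree hconst
    have hls : LOCCIdentifies fun i : s => withAncillas r (productState (v i)) :=
      hl.pullback (fun i : s => (i : ι)) Subtype.val_injective fun i => ⟨1, by simp⟩
    have hsplit := hls.split (v := fun i : s => v i) (fun i q => nz i q)
      (fun i j hij => orth i j fun h => hij (Subtype.ext h))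
      (fun p => if h : p ∈ C then .inr (hfree p h) else .inl (hconst p h))
      (fun _ => Matrix.of fun x y => if x.2 = 0 ∧ x.1 = y then 1 else 0)
      (fun q => ⟨1, one_ne_zero, fun i j => ?_⟩) ?_
    · obtain ⟨p, hp⟩ : C.Nonempty := Finset.card_pos.1 (by omega)
      rcases hsplit with hsub | ⟨p, hpf, B, hB⟩
      · exact absurd ⟨v i₀ p, fun j => ⟨1, by rw [hsub.elim j ⟨i₀, hi₀⟩]; simp⟩⟩
          ((hfree p hp).not_constAt (fun i q => nz i q) ⟨i₀, hi₀⟩)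
      · have hpC : p ∈ C := by
          by_contra h
          exact hpf.not_constAt (fun i q => nz i q) ⟨i₀, hi₀⟩ (hconst p h)
        have hB' : ∀ i ∈ s, ∃ (k : Fin 2) (c : ℂ), v i p = c • B k := fun i hi => hB ⟨i, hi⟩
        have hU : s = ⋃ k, {i | i ∈ s ∧ ∃ c : ℂ, v i p = c • B k} := by
          ext i
          simp only [Set.mem_iUnion, Set.mem_ofPred_eq, exists_and_left]
          exact ⟨fun h => ⟨h, hB' i h⟩, fun h => h.1⟩
        rw [hU]
        refine .node C p hpC B _ (fun k i hi => hi.2) fun k => ih _ _ ?_ ?_ ?_ ?_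
        · rw [Finset.card_erase_of_mem hpC, hC]; rfl
        · by_contra hem
          rw [Set.not_nonempty_iff_eq_empty] at hem
          -- Otherwise the column would be constant, equal to the other basis vector.
          refine hpf.not_constAt (fun i q => nz i q) ⟨i₀, hi₀⟩ ⟨B (1 - k), fun j => ?_⟩
          obtain ⟨l, c, hc⟩ := hB j
          refine ⟨c, ?_⟩
          have hlk : l ≠ k := by
            rintro rfl
            have : (j : ι) ∈ ({i | i ∈ s ∧ ∃ c : ℂ, v i p = c • B l} : Set ι) := ⟨j.2, c, hc⟩
            rw [hem] at this
            exact this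
          rwa [show 1 - k = l by omega]
        · intro q hq
          exact (hfree q (Finset.mem_of_mem_erase hq)).restrict (Finset.ne_of_mem_erase hq) hB' k
        · intro q hq
          by_cases hqp : q = p
          · subst hqp
            exact ⟨B k, fun i => i.2.2⟩
          · obtain ⟨u, hu⟩ := hconst q fun h => hq (Finset.mem_erase.2 ⟨hqp, h⟩)
            exact ⟨u, fun i => hu ⟨i, i.2.1⟩⟩
    · rw [star_mulVec_dotProduct_mulVec, one_mul]
      congr 1
      refine (congrArg (· *ᵥ _) ?_).trans (one_mulVec _)
      ext a b
      simp only [mul_apply, conjTranspose_apply, of_apply, Fintype.sum_prod_type]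
      rw [Finset.sum_eq_single a, Finset.sum_eq_single 0] <;>
        simp +contextual [Matrix.one_apply]
    · funext i
      rw [withAncillas_productState]
      congr 1
      funext q x
      simp only [mulVec, dotProduct, of_apply]
      split_ifs with h <;> simp [h]

/-- A locally distinguishable orthogonal product basis is a tree over all of its columns. -/
theorem tree_of_locc_of_span [Nonempty ι] {v : ι → Fin n → EuclideanSpace ℂ (Fin 2)} {r : ℕ}
    (nz : ∀ i q, v i q ≠ 0)
    (orth : ∀ i j, i ≠ j → star (productState (v i)) ⬝ᵥ productState (v j) = 0)
    (hspan : Submodule.span ℂ (Set.range fun i => productState (v i)) = ⊤)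
    (hl : LOCCIdentifies fun i => withAncillas r (productState (v i))) :
    Tree v Finset.univ Set.univ := by
  refine tree_of_locc nz orth hl _ _ _ rfl Set.univ_nonempty (fun p _ G i => ?_)
    (fun p hp => absurd (Finset.mem_univ p) hp)
  have : Set.range (fun i : (Set.univ : Set ι) => productState (v i))
      = Set.range fun i => productState (v i) := by
    ext φ; simp
  rw [this, hspan]
  trivial

end LOCCToTree

/-! ### From trees to LOCC protocols -/

section TreeToLOCC

variable {n : ℕ} {ι : Type}

/-- The projection onto `B k`, on a qubit with a trivial ancilla. -/
noncomputable def projKraus (B : QubitBasis) (k : Fin 2) : Matrix (Fin 2 × Fin 1) (Fin 2 × Fin 1) ℂ :=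
  Matrix.of fun x y => ketBra (B k) (B k) x.1 y.1

lemma sum_ketBra (B : QubitBasis) : ∑ k, ketBra (B k) (B k) = 1 := by
  refine Matrix.ext_of_mulVec_single fun i => ?_
  have h := B.sum_repr (WithLp.toLp 2 (Pi.single i 1))
  rw [sum_mulVec, one_mulVec]
  have h2 := congrArg WithLp.ofLp h
  simp only at h2
  conv_rhs => rw [← h2]
  rw [Fin.sum_univ_two, Fin.sum_univ_two]
  simp only [ketBra_mulVec, OrthonormalBasis.repr_apply_apply,
    EuclideanSpace.inner_eq_star_dotProduct, WithLp.ofLp_add, WithLp.ofLp_smul]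
  rw [dotProduct_comm, dotProduct_comm (star (B 1).ofLp)]

lemma projKraus_complete (B : QubitBasis) :
    ∑ k, (projKraus B k)ᴴ * projKraus B k = 1 := by
  have h1 : ∀ k, (projKraus B k)ᴴ * projKraus B k
      = Matrix.of fun x y => ketBra (B k) (B k) x.1 y.1 := by
    intro k
    have h2 : (ketBra (B k) (B k))ᴴ * ketBra (B k) (B k) = ketBra (B k) (B k) := by
      rw [ketBra, conjTranspose_vecMulVec, star_star, vecMulVec_mul_vecMulVec,
        QubitBasis.star_dotProduct]
      simp
    ext x y
    conv_rhs => rw [of_apply, ← h2]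
    simp [projKraus, mul_apply, Fintype.sum_prod_type]
  ext x y
  simp only [h1]
  rw [Matrix.sum_apply]
  have := congrFun (congrFun (sum_ketBra B) x.1) y.1
  rw [Matrix.sum_apply] at this
  simp only [of_apply]
  rw [this]
  simp [one_apply, Prod.ext_iff, Subsingleton.elim x.2 y.2]

lemma applyLocal_projKraus (B : QubitBasis) (k : Fin 2) (p : Fin n)
    (w : Fin n → EuclideanSpace ℂ (Fin 2)) :
    applyLocal p (projKraus B k) (withAncillas 0 (productState w))
      = withAncillas 0 (tprod (Function.update (fun q => (w q).ofLp) p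
          (ketBra (B k) (B k) *ᵥ (w p).ofLp))) := by
  rw [← applyLocal_tprod, ← productState_eq_tprod]
  ext x
  have hw : ∀ (φ : QState n) x, withAncillas 0 φ x = φ (fun i => (x i).1) := fun φ x =>
    if_pos fun i => Subsingleton.elim (α := Fin 1) _ _
  simp only [hw, applyLocal, projKraus, of_apply, Fintype.sum_prod_type]
  refine Finset.sum_congr rfl fun y _ => ?_
  rw [Finset.sum_eq_single 0 (fun b _ hb => absurd (Subsingleton.elim b 0) hb)
    (fun h => absurd (Finset.mem_univ _) h)]
  congr 2
  funext i
  by_cases hi : i = p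
  · subst hi; simp
  · simp [hi]

/-- The states of a tree are identified by the measurements of the tree. -/
theorem Tree.locc {v : ι → Fin n → EuclideanSpace ℂ (Fin 2)} {C : Finset (Fin n)} {s : Set ι}
    (h : Tree v C s) : ∀ ψ : ι → MultiState (Fin 2 × Fin 1) n, (∀ i ∉ s, ψ i = 0) →
      (∀ i ∈ s, ψ i = withAncillas 0 (productState (v i))) → LOCCIdentifies ψ := by
  induction h with
  | leaf i₀ =>
    intro ψ h0 _
    have h1 : ∀ i, ψ i ≠ 0 → i = i₀ := fun i hi => by
      by_contra h
      exact hi (h0 i h)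
    exact .done _ fun i j hi hj => (h1 i hi).trans (h1 j hj).symm
  | node C p hp B t hB next ih =>
    intro ψ h0 h1
    refine .measure _ p 2 (projKraus B) (projKraus_complete B) fun k => ih k _ ?_ ?_
    · intro i hi
      by_cases his : i ∈ ⋃ k, t k
      · obtain ⟨l, hl⟩ := Set.mem_iUnion.1 his
        have hkl : k ≠ l := by rintro rfl; exact hi hl
        obtain ⟨c, hc⟩ := hB l i hl
        rw [h1 i his, applyLocal_projKraus, hc, ketBra_self_mulVec_of_ne B hkl, tprod_update_zero]
        ext x
        simp [withAncillas]
      · rw [h0 i his]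
        exact (applyLocalLin p _).map_zero
    · intro i hi
      rw [h1 i (Set.mem_iUnion.2 ⟨k, hi⟩), applyLocal_projKraus]
      obtain ⟨c, hc⟩ := hB k i hi
      congr 1
      rw [productState_eq_tprod]
      congr 1
      rw [Function.update_eq_self_iff, hc, ketBra_self_mulVec]

/-- A set of states which are, up to scalar factors, distinct members of a tree is locally
distinguishable. -/
theorem Tree.locallyDistinguishable {v : ι → Fin n → EuclideanSpace ℂ (Fin 2)}
    {C : Finset (Fin n)} (h : Tree v C Set.univ) {A : Set (QState n)} (f : A → ι)
    (hf : Function.Injective f)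
    (hA : ∀ ψ : A, ∃ c : ℂ, (ψ : QState n) = c • productState (v (f ψ))) :
    LocallyDistinguishable A := by
  refine ⟨0, (h.locc (fun i => withAncillas 0 (productState (v i)))
    (fun i hi => absurd (Set.mem_univ i) hi) fun _ _ => rfl).pullback f hf fun ψ => ?_⟩
  obtain ⟨c, hc⟩ := hA ψ
  refine ⟨c, ?_⟩
  ext x
  simp only [withAncillas, hc, Pi.smul_apply, smul_eq_mul, mul_ite, mul_zero]

end TreeToLOCC

/-! ### Equivalences and product states -/

section Equivalence

/-- A unitary matrix as an isometry of the qubit space. -/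
noncomputable def act (U : unitaryGroup (Fin 2) ℂ) :
    EuclideanSpace ℂ (Fin 2) ≃ₗᵢ[ℂ] EuclideanSpace ℂ (Fin 2) :=
  Unitary.linearIsometryEquiv
    ⟨toEuclideanCLM (n := Fin 2) (𝕜 := ℂ) U, Unitary.map_mem toEuclideanCLM U.2⟩

lemma ofLp_act (U : unitaryGroup (Fin 2) ℂ) (w : EuclideanSpace ℂ (Fin 2)) :
    (act U w).ofLp = (U : Matrix (Fin 2) (Fin 2) ℂ) *ᵥ w.ofLp := rfl

lemma act_one (w : EuclideanSpace ℂ (Fin 2)) : act 1 w = w := by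
  ext z
  rw [ofLp_act]
  simp

/-- The computational basis. -/
noncomputable def stdBasis : QubitBasis := EuclideanSpace.basisFun (Fin 2) ℂ

lemma stdBasis_apply (k z : Fin 2) : stdBasis k z = if z = k then 1 else 0 := by
  rw [stdBasis, EuclideanSpace.basisFun_apply, PiLp.single_apply]

variable {n : ℕ}

lemma applyProductUnitary_productState (U : Fin n → unitaryGroup (Fin 2) ℂ)
    (w : Fin n → EuclideanSpace ℂ (Fin 2)) :
    applyProductUnitary U (productState w) = productState fun i => act (U i) (w i) := by
  ext x
  simp only [applyProductUnitary, productState, ofLp_act, mulVec, dotProduct, Finset.prod_univ_sum,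
    Fintype.piFinset_univ, Finset.prod_mul_distrib]

lemma permuteSystems_productState (σ : Equiv.Perm (Fin n))
    (w : Fin n → EuclideanSpace ℂ (Fin 2)) :
    permuteSystems σ (productState w) = productState fun i => w (σ.symm i) := by
  ext x
  exact Fintype.prod_equiv σ _ _ fun i => by simp

lemma applyProductUnitary_smul (U : Fin n → unitaryGroup (Fin 2) ℂ) (c : ℂ) (ψ : QState n) :
    applyProductUnitary U (c • ψ) = c • applyProductUnitary U ψ := by
  ext x
  simp [applyProductUnitary, Finset.mul_sum, mul_left_comm]

lemma applyProductUnitary_inv (U : Fin n → unitaryGroup (Fin 2) ℂ) (ψ : QState n) :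
    applyProductUnitary U⁻¹ (applyProductUnitary U ψ) = ψ := by
  ext x
  have h1 : ∀ z : Fin n → Fin 2, ∑ y : Fin n → Fin 2,
      (∏ i, ((U⁻¹ i : unitaryGroup (Fin 2) ℂ) : Matrix (Fin 2) (Fin 2) ℂ) (x i) (y i))
        * ∏ i, (U i : Matrix (Fin 2) (Fin 2) ℂ) (y i) (z i) = if x = z then 1 else 0 := by
    intro z
    have h2 : ∀ i, ∑ y : Fin 2,
        ((U⁻¹ i : unitaryGroup (Fin 2) ℂ) : Matrix (Fin 2) (Fin 2) ℂ) (x i) y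
          * (U i : Matrix (Fin 2) (Fin 2) ℂ) y (z i) = if x i = z i then 1 else 0 := by
      intro i
      have h3 : ((U⁻¹ i * U i : unitaryGroup (Fin 2) ℂ) : Matrix (Fin 2) (Fin 2) ℂ) = 1 := by
        simp
      rw [← Matrix.one_apply, ← h3]
      rfl
    simp only [← Finset.prod_mul_distrib]
    have h4 := Finset.prod_univ_sum (fun _ : Fin n => (Finset.univ : Finset (Fin 2)))
      fun i y => ((U⁻¹ i : unitaryGroup (Fin 2) ℂ) : Matrix (Fin 2) (Fin 2) ℂ) (x i) y
          * (U i : Matrix (Fin 2) (Fin 2) ℂ) y (z i)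
    rw [Fintype.piFinset_univ] at h4
    rw [← h4, Finset.prod_congr rfl fun i _ => h2 i]
    split_ifs with hxz
    · simp [hxz]
    · obtain ⟨i, hi⟩ := Function.ne_iff.1 hxz
      exact Finset.prod_eq_zero (Finset.mem_univ i) (if_neg hi)
  simp only [applyProductUnitary, Finset.mul_sum]
  rw [Finset.sum_comm]
  simp only [← mul_assoc, ← Finset.sum_mul, h1]
  simp

/-- A state that an equivalence maps to a multiple of a product state is a multiple of an explicit
product state. -/
lemma eq_smul_productState_of_image {σ : Equiv.Perm (Fin n)} {U : Fin n → unitaryGroup (Fin 2) ℂ}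
    {ψ : QState n} {c : ℂ} {w : Fin n → EuclideanSpace ℂ (Fin 2)}
    (h : applyProductUnitary U (permuteSystems σ ψ) = c • productState w) :
    ψ = c • productState fun i => act (U (σ i))⁻¹ (w (σ i)) := by
  have h1 := congrArg (applyProductUnitary U⁻¹) h
  rw [applyProductUnitary_inv, applyProductUnitary_smul, applyProductUnitary_productState] at h1
  have h2 : ψ = permuteSystems σ.symm (permuteSystems σ ψ) := by
    ext x; simp [permuteSystems]
  rw [h2, h1]
  exact congrArg (c • ·) (permuteSystems_productState σ.symm _)

end Equivalence

/-! ### Building and transporting trees -/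

section Transport

variable {m n : ℕ} {ι ι' : Type}

lemma Tree.transport {v : ι → Fin n → EuclideanSpace ℂ (Fin 2)}
    {v' : ι' → Fin m → EuclideanSpace ℂ (Fin 2)}
    (L : Fin n → EuclideanSpace ℂ (Fin 2) ≃ₗᵢ[ℂ] EuclideanSpace ℂ (Fin 2)) (f : ι → ι')
    (g : Fin n ↪ Fin m) (h : ∀ i j, v' (f i) (g j) = L j (v i j)) {C : Finset (Fin n)} {s : Set ι}
    (ht : Tree v C s) : Tree v' (C.map g) (f '' s) := by
  induction ht with
  | leaf i =>
    rw [Set.image_singleton]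
    exact .leaf (f i)
  | node C p hp B t hB next ih =>
    rw [Set.image_iUnion]
    refine .node _ (g p) (Finset.mem_map_of_mem g hp) (B.map (L p)) _ ?_ fun k => ?_
    · rintro k _ ⟨i, hi, rfl⟩
      obtain ⟨c, hc⟩ := hB k i hi
      exact ⟨c, by rw [h, hc, map_smul, OrthonormalBasis.map_apply]⟩
    · rw [← Finset.map_erase]
      exact ih k

/-- Trees are invariant under equivalences. -/
lemma Tree.equivalence {v : ι → Fin n → EuclideanSpace ℂ (Fin 2)} (σ : Equiv.Perm (Fin n))
    (U : Fin n → unitaryGroup (Fin 2) ℂ) (ht : Tree v Finset.univ Set.univ) :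
    Tree (fun i j => act (U (σ j))⁻¹ (v i (σ j))) Finset.univ Set.univ := by
  have := ht.transport (v' := fun i j => act (U (σ j))⁻¹ (v i (σ j)))
    (fun j => act (U j)⁻¹) id σ.symm.toEmbedding (fun i j => by simp)
  simpa [Finset.map_univ_equiv] using this

/-- Restriction of a tree to the columns in the range of `g`. -/
lemma Tree.comap {v : ι → Fin m → EuclideanSpace ℂ (Fin 2)} (g : Fin n ↪ Fin m)
    {D : Finset (Fin m)} {s : Set ι} (ht : Tree v D s) :
    ∀ C : Finset (Fin n), D = C.map g → Tree (fun i j => v i (g j)) C s := by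
  induction ht with
  | leaf i =>
    intro C hC
    rw [Finset.map_eq_empty.1 hC.symm]
    exact .leaf i
  | node D p hp B t hB next ih =>
    rintro C rfl
    obtain ⟨q, hq, rfl⟩ := Finset.mem_map.1 hp
    exact .node C q hq B t hB fun k => ih k _ (Finset.map_erase g C q).symm

/-- A tree whose root measures system `p` of a family indexed by a pair. -/
lemma Tree.pair {τ : Type} {v : ι → Fin n → EuclideanSpace ℂ (Fin 2)} (e : Fin 2 → τ → ι)
    {C : Finset (Fin n)} (p : Fin n) (hp : p ∈ C) (B : QubitBasis)
    (hB : ∀ k x, v (e k x) p = B k) (next : ∀ k, Tree v (C.erase p) (Set.range (e k))) :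
    Tree v C (Set.range fun x : Fin 2 × τ => e x.1 x.2) := by
  have h : (Set.range fun x : Fin 2 × τ => e x.1 x.2) = ⋃ k, Set.range (e k) := by
    ext i; simp
  rw [h]
  refine .node C p hp B _ ?_ next
  rintro k _ ⟨x, rfl⟩
  exact ⟨1, by rw [hB, one_smul]⟩

/-- A tree with the one column `p`. -/
lemma Tree.two {v : ι → Fin n → EuclideanSpace ℂ (Fin 2)} (e : Fin 2 → ι)
    {C : Finset (Fin n)} (p : Fin n) (hC : C = {p}) (B : QubitBasis)
    (hB : ∀ k, v (e k) p = B k) : Tree v C (Set.range e) := by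
  have h : (Set.range e) = ⋃ k, {e k} := by
    ext i; simp [eq_comm]
  rw [h]
  refine .node C p (by simp [hC]) B _ ?_ fun k => ?_
  · rintro k _ rfl
    exact ⟨1, by rw [hB, one_smul]⟩
  · subst hC
    simpa using Tree.leaf (v := v) (e k)

end Transport

/-! ### Trees of the explicit matrices -/

section Binary

/-- The vectors in the rows of an orthogonal product matrix; the second component of the index
selects the value of a star. -/
noncomputable def OPM.vec {n : ℕ} (M : OPM n) (ν : Assignment) (i : Fin M.rows × Fin 2) (j : Fin n) :
    EuclideanSpace ℂ (Fin 2) :=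
  (M.entry i.1 j).vec ν i.1 i.2

/-- The number with binary digits `l m`. -/
def bits₂ (l m : Fin 2) : Fin 4 := ⟨2 * l + m, by omega⟩

/-- The number with binary digits `k l m`. -/
def bits₃ (k l m : Fin 2) : Fin 8 := ⟨4 * k + 2 * l + m, by omega⟩

/-- Four pairs of rows in which the first digit of the row number decides column `0`, the second
digit column `q l`, and the star column `q' l`. -/
lemma tree_of_bits₂ {v : Fin 4 × Fin 2 → Fin 3 → EuclideanSpace ℂ (Fin 2)} (q q' : Fin 2 → Fin 3)
    (hq : ∀ l, q l ∈ Finset.univ.erase 0 ∧ (Finset.univ.erase 0).erase (q l) = {q' l})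
    (B₀ : QubitBasis) (B₁ : Fin 2 → QubitBasis) (B₂ : Fin 2 → Fin 2 → QubitBasis)
    (h : ∀ l m t, v (bits₂ l m, t) 0 = B₀ l ∧ v (bits₂ l m, t) (q l) = B₁ l m ∧
      v (bits₂ l m, t) (q' l) = B₂ l m t) : Tree v Finset.univ Set.univ := by
  have huniv : Set.univ
      = Set.range fun x : Fin 2 × (Fin 2 × Fin 2) => (bits₂ x.1 x.2.1, x.2.2) :=
    (Set.range_eq_univ.2 (by change ∀ b, ∃ a, _; decide)).symm
  rw [huniv]
  refine Tree.pair (fun l (x : Fin 2 × Fin 2) => (bits₂ l x.1, x.2)) 0 (Finset.mem_univ 0) B₀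
    (fun l x => (h l x.1 x.2).1) fun l => ?_
  refine Tree.pair (fun m t => (bits₂ l m, t)) (q l) (hq l).1 (B₁ l)
    (fun m t => (h l m t).2.1) fun m => ?_
  exact Tree.two _ (q' l) (hq l).2 (B₂ l m) fun t => (h l m t).2.2

/-- Eight pairs of rows in which the first digit of the row number decides column `0`, the second
digit column `q k`, the third digit column `q' k l`, and the star column `q'' k l`. -/
lemma tree_of_bits₃ {v : Fin 8 × Fin 2 → Fin 4 → EuclideanSpace ℂ (Fin 2)} (q : Fin 2 → Fin 4)
    (q' q'' : Fin 2 → Fin 2 → Fin 4)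
    (hq : ∀ k l, q k ∈ Finset.univ.erase 0 ∧ q' k l ∈ (Finset.univ.erase 0).erase (q k) ∧
      ((Finset.univ.erase 0).erase (q k)).erase (q' k l) = {q'' k l})
    (B₀ : QubitBasis) (B₁ : Fin 2 → QubitBasis) (B₂ : Fin 2 → Fin 2 → QubitBasis)
    (B₃ : Fin 2 → Fin 2 → Fin 2 → QubitBasis)
    (h : ∀ k l m t, v (bits₃ k l m, t) 0 = B₀ k ∧ v (bits₃ k l m, t) (q k) = B₁ k l ∧
      v (bits₃ k l m, t) (q' k l) = B₂ k l m ∧ v (bits₃ k l m, t) (q'' k l) = B₃ k l m t) :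
    Tree v Finset.univ Set.univ := by
  have huniv : Set.univ = Set.range
      fun x : Fin 2 × (Fin 2 × (Fin 2 × Fin 2)) => (bits₃ x.1 x.2.1 x.2.2.1, x.2.2.2) :=
    (Set.range_eq_univ.2 (by change ∀ b, ∃ a, _; decide)).symm
  rw [huniv]
  refine Tree.pair (fun k (x : Fin 2 × (Fin 2 × Fin 2)) => (bits₃ k x.1 x.2.1, x.2.2)) 0
    (Finset.mem_univ 0) B₀ (fun k x => (h k x.1 x.2.1 x.2.2).1) fun k => ?_
  refine Tree.pair (fun l (x : Fin 2 × Fin 2) => (bits₃ k l x.1, x.2)) (q k) (hq k 0).1 (B₁ k)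
    (fun l x => (h k l x.1 x.2).2.1) fun l => ?_
  refine Tree.pair (fun m t => (bits₃ k l m, t)) (q' k l) (hq k l).2.1 (B₂ k l)
    (fun m t => (h k l m t).2.2.1) fun m => ?_
  exact Tree.two _ (q'' k l) (hq k l).2.2 (B₃ k l m) fun t => (h k l m t).2.2.2

lemma tree_M32 (ν : Assignment) : Tree (M32.vec ν) Finset.univ Set.univ :=
  tree_of_bits₂ (v := M32.vec ν) ![1, 1] ![2, 2] (by decide) stdBasis ![stdBasis, ν.var .e]
    (fun l m => ν.star (bits₂ l m)) (by
      intro l m t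
      fin_cases l <;> fin_cases m <;> exact ⟨rfl, rfl, rfl⟩)

lemma tree_M33 (ν : Assignment) : Tree (M33.vec ν) Finset.univ Set.univ :=
  tree_of_bits₂ (v := M33.vec ν) ![1, 2] ![2, 1] (by decide) stdBasis ![stdBasis, ν.var .e]
    (fun l m => ν.star (bits₂ l m)) (by
      intro l m t
      fin_cases l <;> fin_cases m <;> exact ⟨rfl, rfl, rfl⟩)

/-- The matrices `M_{41}, …, M_{46}` are trees. -/
lemma tree_firstSix {M : OPM 4} (hM : M ∈ firstSix) (ν : Assignment) :
    Tree (M.vec ν) Finset.univ Set.univ := by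
  simp only [firstSix, List.mem_cons, List.not_mem_nil, or_false] at hM
  rcases hM with rfl | rfl | rfl | rfl | rfl | rfl
  · exact tree_of_bits₃ (v := M41.vec ν) ![1, 1] ![![2, 2], ![2, 2]] ![![3, 3], ![3, 3]]
      (by decide) stdBasis ![stdBasis, ν.var .b]
      ![![stdBasis, ν.var .c], ![ν.var .x, ν.var .y]] (fun k l m => ν.star (bits₃ k l m)) (by
        intro k l m t
        fin_cases k <;> fin_cases l <;> fin_cases m <;> exact ⟨rfl, rfl, rfl, rfl⟩)
  · exact tree_of_bits₃ (v := M42.vec ν) ![1, 1] ![![3, 2], ![2, 2]] ![![2, 3], ![3, 3]]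
      (by decide) stdBasis ![stdBasis, ν.var .b]
      ![![stdBasis, stdBasis], ![ν.var .c, ν.var .x]] (fun k l m => ν.star (bits₃ k l m)) (by
        intro k l m t
        fin_cases k <;> fin_cases l <;> fin_cases m <;> exact ⟨rfl, rfl, rfl, rfl⟩)
  · exact tree_of_bits₃ (v := M43.vec ν) ![1, 1] ![![2, 3], ![3, 2]] ![![3, 2], ![2, 3]]
      (by decide) stdBasis ![stdBasis, ν.var .b]
      ![![stdBasis, stdBasis], ![ν.var .d, ν.var .c]] (fun k l m => ν.star (bits₃ k l m)) (by
        intro k l m t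
        fin_cases k <;> fin_cases l <;> fin_cases m <;> exact ⟨rfl, rfl, rfl, rfl⟩)
  · exact tree_of_bits₃ (v := M44.vec ν) ![1, 1] ![![2, 2], ![3, 3]] ![![3, 3], ![2, 2]]
      (by decide) stdBasis ![stdBasis, ν.var .b]
      ![![stdBasis, ν.var .c], ![stdBasis, ν.var .d]] (fun k l m => ν.star (bits₃ k l m)) (by
        intro k l m t
        fin_cases k <;> fin_cases l <;> fin_cases m <;> exact ⟨rfl, rfl, rfl, rfl⟩)
  · exact tree_of_bits₃ (v := M45.vec ν) ![1, 2] ![![3, 2], ![1, 1]] ![![2, 3], ![3, 3]]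
      (by decide) stdBasis ![stdBasis, stdBasis]
      ![![stdBasis, ν.var .c], ![ν.var .b, ν.var .x]] (fun k l m => ν.star (bits₃ k l m)) (by
        intro k l m t
        fin_cases k <;> fin_cases l <;> fin_cases m <;> exact ⟨rfl, rfl, rfl, rfl⟩)
  · exact tree_of_bits₃ (v := M46.vec ν) ![1, 2] ![![3, 3], ![1, 1]] ![![2, 2], ![3, 3]]
      (by decide) stdBasis ![stdBasis, stdBasis]
      ![![stdBasis, ν.var .d], ![ν.var .b, ν.var .x]] (fun k l m => ν.star (bits₃ k l m)) (by
        intro k l m t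
        fin_cases k <;> fin_cases l <;> fin_cases m <;> exact ⟨rfl, rfl, rfl, rfl⟩)

/-- Distinct states of an orthogonal product matrix have distinct rows, so a tree over its rows
distinguishes its states. -/
lemma OPM.locallyDistinguishable_of_tree {n : ℕ} {M : OPM n} {ν : Assignment}
    (h : Tree (M.vec ν) Finset.univ Set.univ) : LocallyDistinguishable (M.states ν) := by
  have hex : ∀ ψ : M.states ν, ∃ i, (ψ : QState n) = productState (M.vec ν i) := by
    rintro ⟨_, r, t, rfl⟩
    exact ⟨(r, t), rfl⟩
  choose f hf using hex
  exact h.locallyDistinguishable f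
    (fun ψ χ hψχ => Subtype.ext (by rw [hf ψ, hf χ, hψχ])) fun ψ => ⟨1, by rw [one_smul, hf ψ]⟩

end Binary

/-! ### Splitting sets are locally distinguishable -/

section SplitsToLOCC

/-- The members of `T` are, up to scalar factors, product states `w i` that form a tree. -/
lemma EquivalentToM32OrM33.exists_tree {T : Set (QState 3)} (h : EquivalentToM32OrM33 T) :
    ∃ w : Fin 4 × Fin 2 → Fin 3 → EuclideanSpace ℂ (Fin 2), Tree w Finset.univ Set.univ ∧
      ∀ φ ∈ T, ∃ i, ∃ c : ℂ, φ = c • productState (w i) := by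
  obtain ⟨ν, ⟨σ, U, hU, -⟩ | ⟨σ, U, hU, -⟩⟩ := h
  · refine ⟨_, (tree_M32 ν).equivalence σ U, fun φ hφ => ?_⟩
    obtain ⟨_, ⟨r, t, rfl⟩, c, -, hc⟩ := hU φ hφ
    exact ⟨(r, t), c, eq_smul_productState_of_image hc⟩
  · refine ⟨_, (tree_M33 ν).equivalence σ U, fun φ hφ => ?_⟩
    obtain ⟨_, ⟨r, t, rfl⟩, c, -, hc⟩ := hU φ hφ
    exact ⟨(r, t), c, eq_smul_productState_of_image hc⟩

lemma ket_productState {n : ℕ} (k : Fin 2) (c : ℂ) (w : Fin n → EuclideanSpace ℂ (Fin 2)) :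
    (fun x : Fin (n + 1) → Fin 2 => if x 0 = k then (c • productState w) (fun i => x i.succ) else 0)
      = c • productState (Fin.cons (stdBasis k) w : Fin (n + 1) → EuclideanSpace ℂ (Fin 2)) := by
  ext x
  simp only [Pi.smul_apply, smul_eq_mul, productState, Fin.prod_univ_succ, Fin.cons_zero,
    Fin.cons_succ, stdBasis_apply]
  split_ifs <;> simp

theorem Splits.locallyDistinguishable {A : Set (QState 4)} (hA0 : ∀ ψ ∈ A, ψ ≠ 0)
    (hA : ∀ ψ ∈ A, ∀ χ ∈ A, ψ ≠ χ → star ψ ⬝ᵥ χ = 0) (h : Splits A) :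
    LocallyDistinguishable A := by
  obtain ⟨T₀, T₁, h₀, h₁, σ, U, hU, -⟩ := h
  obtain ⟨w₀, ht₀, hw₀⟩ := h₀.exists_tree
  obtain ⟨w₁, ht₁, hw₁⟩ := h₁.exists_tree
  set w : Fin 2 → Fin 4 × Fin 2 → Fin 3 → EuclideanSpace ℂ (Fin 2) := ![w₀, w₁] with hw
  set v : Fin 2 × (Fin 4 × Fin 2) → Fin 4 → EuclideanSpace ℂ (Fin 2) :=
    fun x => Fin.cons (stdBasis x.1) (w x.1 x.2) with hv
  have htw : ∀ k, Tree (w k) Finset.univ Set.univ := by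
    intro k; fin_cases k
    · exact ht₀
    · exact ht₁
  have htv : Tree v Finset.univ Set.univ := by
    have huniv : (Set.univ : Set (Fin 2 × (Fin 4 × Fin 2)))
        = Set.range fun x : Fin 2 × (Fin 4 × Fin 2) => (x.1, x.2) := by simp
    rw [huniv]
    refine Tree.pair Prod.mk 0 (Finset.mem_univ 0) stdBasis (fun k x => rfl) fun k => ?_
    have h1 := (htw k).transport (v' := v) (fun _ => LinearIsometryEquiv.refl ℂ _) (Prod.mk k)
      (Fin.succEmb 3) fun i j => rfl
    rw [Set.image_univ] at h1
    rwa [show Finset.map (Fin.succEmb 3) Finset.univ = Finset.univ.erase 0 by decide] at h1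
  -- Every state of `A` is a multiple of a transformed tree member.
  have hex : ∀ ψ : A, ∃ i, ∃ c : ℂ,
      (ψ : QState 4) = c • productState fun j => act (U (σ j))⁻¹ (v i (σ j)) := by
    rintro ⟨ψ, hψ⟩
    obtain ⟨_, hφ, c, -, hc⟩ := hU ψ hψ
    have hket : ∃ k, ∃ i, ∃ d : ℂ, applyProductUnitary U (permuteSystems σ ψ)
        = (c * d) • productState (v (k, i)) := by
      rcases hφ with ⟨φ, hφT, rfl⟩ | ⟨φ, hφT, rfl⟩
      · obtain ⟨i, d, rfl⟩ := hw₀ φ hφT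
        exact ⟨0, i, d, by rw [hc, ket_productState, smul_smul]; rfl⟩
      · obtain ⟨i, d, rfl⟩ := hw₁ φ hφT
        exact ⟨1, i, d, by rw [hc, ket_productState, smul_smul]; rfl⟩
    obtain ⟨k, i, d, hd⟩ := hket
    exact ⟨(k, i), c * d, eq_smul_productState_of_image hd⟩
  choose f c hf using hex
  refine (htv.equivalence σ U).locallyDistinguishable f (fun ψ χ hψχ => ?_) fun ψ => ⟨c ψ, hf ψ⟩
  -- Proportional nonzero states are not orthogonal.
  by_contra hne
  have h1 := hA ψ ψ.2 χ χ.2 fun h => hne (Subtype.ext h)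
  have hψ0 := hA0 ψ ψ.2
  have hχ0 := hA0 χ χ.2
  rw [hf] at hψ0 hχ0
  rw [hf ψ, hf χ, hψχ, star_smul, smul_dotProduct, dotProduct_smul, smul_eq_mul,
    smul_eq_mul] at h1
  rcases mul_eq_zero.1 h1 with h2 | h2
  · exact (smul_ne_zero_iff.1 hψ0).1 (star_eq_zero.1 h2)
  · rcases mul_eq_zero.1 h2 with h3 | h3
    · exact (smul_ne_zero_iff.1 hχ0).1 h3
    · exact star_dotProduct_self_ne_zero (smul_ne_zero_iff.1 hχ0).2 h3

end SplitsToLOCC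

/-! ### Trees split -/

section TreeToSplits

variable {n : ℕ} {ι : Type}

/-- The unitary that maps the basis `B` to the computational basis. -/
noncomputable def basisUnitary (B : QubitBasis) : unitaryGroup (Fin 2) ℂ :=
  ⟨Matrix.of fun k z => star (B k z), by
    rw [mem_unitaryGroup_iff]
    ext k l
    rw [one_apply, ← QubitBasis.star_dotProduct B k l]
    simp [mul_apply, dotProduct]⟩

lemma act_basisUnitary (B : QubitBasis) (k : Fin 2) : act (basisUnitary B) (B k) = stdBasis k := by
  ext z
  rw [ofLp_act, stdBasis_apply]
  exact QubitBasis.star_dotProduct B z k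

lemma Tree.exists_node {v : ι → Fin n → EuclideanSpace ℂ (Fin 2)} {C : Finset (Fin n)} {s : Set ι}
    (h : Tree v C s) (hC : C.Nonempty) : ∃ p ∈ C, ∃ (B : QubitBasis) (t : Fin 2 → Set ι),
      s = ⋃ k, t k ∧ (∀ k, ∀ i ∈ t k, ∃ c : ℂ, v i p = c • B k) ∧
      ∀ k, Tree v (C.erase p) (t k) := by
  cases h with
  | leaf i => exact absurd hC Finset.not_nonempty_empty
  | node C p hp B t hB next => exact ⟨p, hp, B, t, rfl, hB, next⟩

lemma Tree.exists_leaf {v : ι → Fin n → EuclideanSpace ℂ (Fin 2)} {C : Finset (Fin n)} {s : Set ι}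
    (h : Tree v C s) (hC : C = ∅) : ∃ i, s = {i} := by
  cases h with
  | leaf i => exact ⟨i, rfl⟩
  | node C p hp => exact absurd (hC ▸ hp) (Finset.notMem_empty p)

lemma proportional_productState {a b : Fin n → EuclideanSpace ℂ (Fin 2)}
    (h : ∀ j, ∃ c : ℂ, c ≠ 0 ∧ a j = c • b j) :
    Proportional (productState a) (productState b) := by
  choose c hc hab using h
  refine ⟨∏ j, c j, Finset.prod_ne_zero_iff.2 fun j _ => hc j, ?_⟩
  ext x
  simp [productState, hab, Finset.prod_mul_distrib]

lemma equivalent_range {F G : ι → QState n} (σ : Equiv.Perm (Fin n))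
    (U : Fin n → unitaryGroup (Fin 2) ℂ)
    (h : ∀ i, Proportional (applyProductUnitary U (permuteSystems σ (F i))) (G i)) :
    Equivalent (Set.range F) (Set.range G) := by
  refine ⟨σ, U, ?_, ?_⟩
  · rintro _ ⟨i, rfl⟩
    exact ⟨_, ⟨i, rfl⟩, h i⟩
  · rintro _ ⟨i, rfl⟩
    exact ⟨_, ⟨i, rfl⟩, h i⟩

lemma OPM.states_eq_range (M : OPM n) (ν : Assignment) :
    M.states ν = Set.range fun i => productState (M.vec ν i) := by
  ext ψ
  constructor
  · rintro ⟨r, t, rfl⟩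
    exact ⟨(r, t), rfl⟩
  · rintro ⟨⟨r, t⟩, rfl⟩
    exact ⟨r, t, rfl⟩

lemma range_bits₂ {α : Type} (F : Fin 4 × Fin 2 → α) :
    Set.range (fun x : Fin 2 × Fin 2 × Fin 2 => F (bits₂ x.1 x.2.1, x.2.2)) = Set.range F := by
  have hs : Function.Surjective fun x : Fin 2 × Fin 2 × Fin 2 => (bits₂ x.1 x.2.1, x.2.2) := by
    change ∀ b, ∃ a, _
    decide
  exact hs.range_comp F

lemma states_M32 (ν : Assignment) : M32.states ν = Set.range fun x : Fin 2 × Fin 2 × Fin 2 =>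
    productState (M32.vec ν (bits₂ x.1 x.2.1, x.2.2)) :=
  (M32.states_eq_range ν).trans (range_bits₂ _).symm

lemma states_M33 (ν : Assignment) : M33.states ν = Set.range fun x : Fin 2 × Fin 2 × Fin 2 =>
    productState (M33.vec ν (bits₂ x.1 x.2.1, x.2.2)) :=
  (M33.states_eq_range ν).trans (range_bits₂ _).symm

lemma third_unique : ∀ a b c d : Fin 3, c ≠ a → c ≠ b → d ≠ a → d ≠ b → a ≠ b → c = d := by
  decide

lemma exists_perm_three : ∀ a b c : Fin 3, a ≠ b → a ≠ c → b ≠ c →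
    ∃ τ : Equiv.Perm (Fin 3), τ 0 = a ∧ τ 1 = b ∧ τ 2 = c := by
  decide

/-- A tree of three-qubit states is equivalent to `M_{32}` or `M_{33}`: the two branches below the
root measure the same system next, or different ones. -/
theorem Tree.equivalentToM32OrM33 {w : ι → Fin 3 → EuclideanSpace ℂ (Fin 2)}
    (nz : ∀ i j, w i j ≠ 0) {s : Set ι} (h : Tree w Finset.univ s) :
    EquivalentToM32OrM33 ((fun i => productState (w i)) '' s) := by
  obtain ⟨p, -, B, t, hs, hB, ht⟩ := h.exists_node Finset.univ_nonempty
  have hc₁ : ((Finset.univ : Finset (Fin 3)).erase p).card = 2 := by simp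
  choose p₁ hp₁ B₁ t₁ hs₁ hB₁ ht₁ using fun k =>
    (ht k).exists_node (Finset.card_pos.1 (by omega))
  have hc₂ : ∀ k, (((Finset.univ : Finset (Fin 3)).erase p).erase (p₁ k)).card = 1 := fun k => by
    rw [Finset.card_erase_of_mem (hp₁ k), hc₁]
  choose p₂ hp₂ B₂ t₂ hs₂ hB₂ ht₂ using fun k l =>
    (ht₁ k l).exists_node (Finset.card_pos.1 (by rw [hc₂]; omega))
  choose i hi using fun k l m => (ht₂ k l m).exists_leaf
    (Finset.card_eq_zero.1 (by rw [Finset.card_erase_of_mem (hp₂ k l), hc₂]))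
  -- `i k l m` is the leaf reached by the outcomes `k`, `l`, `m` on the systems `p`, `p₁ k`, `p₂ k l`.
  -- Its three factors are nonzero multiples of the basis vectors along this path.
  have scale : ∀ {j q} {u : EuclideanSpace ℂ (Fin 2)}, (∃ c : ℂ, w j q = c • u) →
      ∃ c : ℂ, c ≠ 0 ∧ w j q = c • u := by
    rintro j q u ⟨c, hc⟩
    refine ⟨c, ?_, hc⟩
    rintro rfl
    exact nz j q (by rw [hc, zero_smul])
  have hm₂ : ∀ k l m, i k l m ∈ t₂ k l m := fun k l m => by rw [hi]; rfl
  have hm₁ : ∀ k l m, i k l m ∈ t₁ k l := fun k l m => by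
    rw [hs₂]; exact Set.mem_iUnion.2 ⟨m, hm₂ k l m⟩
  have hm₀ : ∀ k l m, i k l m ∈ t k := fun k l m => by
    rw [hs₁]; exact Set.mem_iUnion.2 ⟨l, hm₁ k l m⟩
  have e₀ : ∀ k l m, ∃ c : ℂ, c ≠ 0 ∧ w (i k l m) p = c • B k := fun k l m =>
    scale (hB k _ (hm₀ k l m))
  have e₁ : ∀ k l m, ∃ c : ℂ, c ≠ 0 ∧ w (i k l m) (p₁ k) = c • B₁ k l := fun k l m =>
    scale (hB₁ k l _ (hm₁ k l m))
  have e₂ : ∀ k l m, ∃ c : ℂ, c ≠ 0 ∧ w (i k l m) (p₂ k l) = c • B₂ k l m := fun k l m =>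
    scale (hB₂ k l m _ (hm₂ k l m))
  have hrange : (fun j => productState (w j)) '' s
      = Set.range fun x : Fin 2 × Fin 2 × Fin 2 => productState (w (i x.1 x.2.1 x.2.2)) := by
    have : s = Set.range fun x : Fin 2 × Fin 2 × Fin 2 => i x.1 x.2.1 x.2.2 := by
      ext j
      simp [hs, hs₁, hs₂, hi, eq_comm]
    rw [this, ← Set.range_comp]
    rfl
  have ne₁ : ∀ k, p₁ k ≠ p := fun k => Finset.ne_of_mem_erase (hp₁ k)
  have ne₂ : ∀ k l, p₂ k l ≠ p₁ k := fun k l => Finset.ne_of_mem_erase (hp₂ k l)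
  have ne₃ : ∀ k l, p₂ k l ≠ p := fun k l =>
    Finset.ne_of_mem_erase (Finset.mem_of_mem_erase (hp₂ k l))
  have h₂ : ∀ k l, p₂ k l = p₂ k 0 := fun k l =>
    third_unique _ _ _ _ (ne₃ k l) (ne₂ k l) (ne₃ k 0) (ne₂ k 0) (ne₁ k).symm
  obtain ⟨τ, hτ₀, hτ₁, hτ₂⟩ := exists_perm_three p (p₁ 0) (p₂ 0 0) (ne₁ 0).symm (ne₃ 0 0).symm
    (ne₂ 0 0).symm
  -- The branch `k = 0` fixes the order of the systems and the unitaries. In the branch `k = 1`, the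
  -- transformed bases become the values of the letter `e` and of the stars.
  set U : Fin 3 → unitaryGroup (Fin 2) ℂ := ![basisUnitary B, basisUnitary (B₁ 0), 1] with hU
  have himage : ∀ j, applyProductUnitary U (permuteSystems τ.symm (productState (w j)))
      = productState fun q => act (U q) (w j (τ q)) := fun j => by
    rw [permuteSystems_productState, applyProductUnitary_productState]
    rfl
  -- `a` is the value of the letter `e`, and `S k l` is the basis of the star in row `2 * k + l`.
  let val (a : QubitBasis) (S : Fin 2 → Fin 2 → QubitBasis) : Assignment :=
    ⟨fun _ => a, fun | 0 => S 0 0 | 1 => S 0 1 | 2 => S 1 0 | _ => S 1 1⟩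
  rw [hrange]
  by_cases hp : p₁ 1 = p₁ 0
  · have h₂' : p₂ 1 0 = p₂ 0 0 :=
      third_unique p (p₁ 0) _ _ (ne₃ 1 0) (hp ▸ ne₂ 1 0) (ne₃ 0 0) (ne₂ 0 0) (ne₁ 0).symm
    refine ⟨val ((B₁ 1).map (act (basisUnitary (B₁ 0)))) B₂, .inl ?_⟩
    rw [states_M32]
    refine equivalent_range τ.symm U fun ⟨k, l, m⟩ => ?_
    rw [himage]
    refine proportional_productState fun q => ?_
    obtain ⟨c₀, hc₀, e₀⟩ := e₀ k l m
    obtain ⟨c₁, hc₁, e₁⟩ := e₁ k l m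
    obtain ⟨c₂, hc₂, e₂⟩ := e₂ k l m
    rw [h₂] at e₂
    fin_cases q
    · refine ⟨c₀, hc₀, ?_⟩
      change act (basisUnitary B) (w (i k l m) (τ 0)) = _
      rw [hτ₀, e₀, map_smul, act_basisUnitary]
      obtain rfl | rfl : k = 0 ∨ k = 1 := (by omega) <;>
        obtain rfl | rfl : l = 0 ∨ l = 1 := (by omega) <;> rfl
    · refine ⟨c₁, hc₁, ?_⟩
      change act (basisUnitary (B₁ 0)) (w (i k l m) (τ 1)) = _
      rw [hτ₁]
      obtain rfl | rfl : k = 0 ∨ k = 1 := by omega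
      · rw [e₁, map_smul, act_basisUnitary]
        obtain rfl | rfl : l = 0 ∨ l = 1 := (by omega) <;> rfl
      · rw [← hp, e₁, map_smul]
        obtain rfl | rfl : l = 0 ∨ l = 1 := (by omega) <;>
          exact congrArg (c₁ • ·) (OrthonormalBasis.map_apply _ _ _).symm
    · refine ⟨c₂, hc₂, ?_⟩
      change act 1 (w (i k l m) (τ 2)) = _
      rw [hτ₂, act_one]
      obtain rfl | rfl : k = 0 ∨ k = 1 := by omega
      · rw [e₂]
        obtain rfl | rfl : l = 0 ∨ l = 1 := (by omega) <;> rfl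
      · rw [← h₂', e₂]
        obtain rfl | rfl : l = 0 ∨ l = 1 := (by omega) <;> rfl
  · have h₁' : p₁ 1 = p₂ 0 0 :=
      third_unique p (p₁ 0) _ _ (ne₁ 1) hp (ne₃ 0 0) (ne₂ 0 0) (ne₁ 0).symm
    have h₂' : p₂ 1 0 = p₁ 0 :=
      third_unique p (p₁ 1) _ _ (ne₃ 1 0) (ne₂ 1 0) (ne₁ 0) (Ne.symm hp) (ne₁ 1).symm
    refine ⟨val (B₁ 1) ![B₂ 0, fun l => (B₂ 1 l).map (act (basisUnitary (B₁ 0)))], .inr ?_⟩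
    rw [states_M33]
    refine equivalent_range τ.symm U fun ⟨k, l, m⟩ => ?_
    rw [himage]
    refine proportional_productState fun q => ?_
    obtain ⟨c₀, hc₀, e₀⟩ := e₀ k l m
    obtain ⟨c₁, hc₁, e₁⟩ := e₁ k l m
    obtain ⟨c₂, hc₂, e₂⟩ := e₂ k l m
    rw [h₂] at e₂
    fin_cases q
    · refine ⟨c₀, hc₀, ?_⟩
      change act (basisUnitary B) (w (i k l m) (τ 0)) = _
      rw [hτ₀, e₀, map_smul, act_basisUnitary]
      obtain rfl | rfl : k = 0 ∨ k = 1 := (by omega) <;>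
        obtain rfl | rfl : l = 0 ∨ l = 1 := (by omega) <;> rfl
    · change ∃ c : ℂ, c ≠ 0 ∧ act (basisUnitary (B₁ 0)) (w (i k l m) (τ 1)) = _
      rw [hτ₁]
      obtain rfl | rfl : k = 0 ∨ k = 1 := by omega
      · refine ⟨c₁, hc₁, ?_⟩
        rw [e₁, map_smul, act_basisUnitary]
        obtain rfl | rfl : l = 0 ∨ l = 1 := (by omega) <;> rfl
      · refine ⟨c₂, hc₂, ?_⟩
        rw [← h₂', e₂, map_smul]
        obtain rfl | rfl : l = 0 ∨ l = 1 := (by omega) <;>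
          exact congrArg (c₂ • ·) (OrthonormalBasis.map_apply _ _ _).symm
    · change ∃ c : ℂ, c ≠ 0 ∧ act 1 (w (i k l m) (τ 2)) = _
      rw [hτ₂, act_one]
      obtain rfl | rfl : k = 0 ∨ k = 1 := by omega
      · refine ⟨c₂, hc₂, ?_⟩
        rw [e₂]
        obtain rfl | rfl : l = 0 ∨ l = 1 := (by omega) <;> rfl
      · refine ⟨c₁, hc₁, ?_⟩
        rw [← h₁', e₁]
        obtain rfl | rfl : l = 0 ∨ l = 1 := (by omega) <;> rfl

/-- The columns other than `p`, listed after `0` and `p` have been exchanged. -/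
def otherColumns (p : Fin 4) : Fin 3 ↪ Fin 4 :=
  (Fin.succEmb 3).trans (Equiv.swap 0 p).toEmbedding

lemma erase_eq_map_otherColumns :
    ∀ p : Fin 4, Finset.univ.erase p = Finset.univ.map (otherColumns p) := by
  decide

/-- A tree of four-qubit states splits: the root of the tree is the splitting qubit, and the two
branches are trees of three-qubit states. -/
theorem Tree.splits {A : Set (QState 4)} {v : A → Fin 4 → EuclideanSpace ℂ (Fin 2)}
    (hv : ∀ ψ : A, (ψ : QState 4) = productState (v ψ)) (nz : ∀ ψ j, v ψ j ≠ 0)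
    (h : Tree v Finset.univ Set.univ) : Splits A := by
  obtain ⟨p, -, B, t, hs, hB, ht⟩ := h.exists_node Finset.univ_nonempty
  set T : Fin 2 → Set (QState 3) := fun k =>
    (fun ψ => productState fun j => v ψ (otherColumns p j)) '' t k with hT
  have hTk : ∀ k, EquivalentToM32OrM33 (T k) := fun k =>
    ((ht k).comap (otherColumns p) _ (erase_eq_map_otherColumns p)).equivalentToM32OrM33
      fun ψ j => nz ψ _
  set U : Fin 4 → unitaryGroup (Fin 2) ℂ := ![basisUnitary B, 1, 1, 1] with hU
  have key : ∀ k, ∀ ψ ∈ t k,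
      Proportional (applyProductUnitary U (permuteSystems (Equiv.swap 0 p) (ψ : QState 4)))
        fun x => if x 0 = k then
          (productState fun j => v ψ (otherColumns p j)) fun i => x i.succ else 0 := by
    intro k ψ hψ
    have h1 := ket_productState k 1 fun j => v ψ (otherColumns p j)
    rw [one_smul, one_smul] at h1
    rw [h1, hv ψ, permuteSystems_productState, applyProductUnitary_productState]
    refine proportional_productState fun j => ?_
    refine Fin.cases ?_ (fun j => ?_) j
    · obtain ⟨c, hc⟩ := hB k ψ hψ
      refine ⟨c, ?_, ?_⟩
      · rintro rfl
        exact nz ψ p (by rw [hc, zero_smul])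
      · rw [Equiv.symm_swap, Equiv.swap_apply_left, hc, map_smul]
        exact congrArg (c • ·) (act_basisUnitary B k)
    · refine ⟨1, one_ne_zero, ?_⟩
      have hUj : U j.succ = 1 := by fin_cases j <;> rfl
      rw [hUj, act_one, one_smul]
      rfl
  refine ⟨T 0, T 1, hTk 0, hTk 1, Equiv.swap 0 p, U, fun ψ hψ => ?_, ?_⟩
  · have hmem : (⟨ψ, hψ⟩ : A) ∈ ⋃ k, t k := hs ▸ Set.mem_univ _
    obtain ⟨k, hk⟩ := Set.mem_iUnion.1 hmem
    refine ⟨_, ?_, key k _ hk⟩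
    fin_cases k
    · exact .inl ⟨_, ⟨_, hk, rfl⟩, rfl⟩
    · exact .inr ⟨_, ⟨_, hk, rfl⟩, rfl⟩
  · rintro _ (⟨_, ⟨ψ, hψ, rfl⟩, rfl⟩ | ⟨_, ⟨ψ, hψ, rfl⟩, rfl⟩)
    · exact ⟨ψ, ψ.2, key 0 ψ hψ⟩
    · exact ⟨ψ, ψ.2, key 1 ψ hψ⟩

end TreeToSplits

/-! ### Formal orthogonal product bases -/

section Symbolic

/-- The entries are orthogonal whatever the values of the symbols are. The flag says that the two
states are the two rows abbreviated by one row with a star. -/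
def Entry.orth (twin : Bool) : Entry → Entry → Bool
  | .zero, .one => true
  | .one, .zero => true
  | .var u, .perp w => u.ctorIdx == w.ctorIdx
  | .perp u, .var w => u.ctorIdx == w.ctorIdx
  | .star, .star => twin
  | _, _ => false

/-- The entry is a star. -/
def Entry.isStar : Entry → Bool
  | .star => true
  | _ => false

variable {n : ℕ}

/-- Indices that list every state once: a row without a star is taken with `t = 0` only. -/
def OPM.Proper (M : OPM n) (i : Fin M.rows × Fin 2) : Prop :=
  i.2 = 0 ∨ ∃ j, (M.entry i.1 j).isStar = true

instance (M : OPM n) : DecidablePred M.Proper := fun _ => inferInstanceAs (Decidable (_ ∨ _))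

/-- The matrix denotes an orthogonal product basis for formal reasons: it has `2 ^ n` states, and
any two of them are formally orthogonal in some column. -/
def OPM.IsFormalOPB (M : OPM n) : Prop :=
  (Finset.univ.filter M.Proper).card = 2 ^ n ∧
  ∀ i j : Fin M.rows × Fin 2, M.Proper i → M.Proper j → i ≠ j →
    ∃ q, (M.entry i.1 q).orth (decide (i.1 = j.1 ∧ i.2 ≠ j.2)) (M.entry j.1 q) = true

instance (M : OPM n) : Decidable M.IsFormalOPB := inferInstanceAs (Decidable (_ ∧ _))

lemma remaining_isFormalOPB : ∀ M ∈ remaining, M.IsFormalOPB := by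
  decide +kernel

lemma Letter.eq_of_ctorIdx {u w : Letter} (h : (u.ctorIdx == w.ctorIdx) = true) : u = w := by
  cases u <;> cases w <;> first | rfl | exact absurd h (by decide)

lemma vec_orthogonal_of_orth (ν : Assignment) {N : ℕ} {r r' : Fin N} {t t' : Fin 2} {e e' : Entry}
    (h : e.orth (decide (r = r' ∧ t ≠ t')) e' = true) :
    star (e.vec ν r t).ofLp ⬝ᵥ (e'.vec ν r' t').ofLp = 0 := by
  have hB : ∀ (B : QubitBasis) {k l : Fin 2}, k ≠ l → star (B k).ofLp ⬝ᵥ (B l).ofLp = 0 :=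
    fun B k l hkl => by rw [QubitBasis.star_dotProduct, if_neg hkl]
  cases e <;> cases e' <;> try (simp [Entry.orth] at h; done)
  case zero.one => exact hB stdBasis Fin.zero_ne_one
  case one.zero => exact hB stdBasis Fin.zero_ne_one.symm
  case var.perp u w =>
    obtain rfl := Letter.eq_of_ctorIdx h
    exact hB (ν.var u) Fin.zero_ne_one
  case perp.var u w =>
    obtain rfl := Letter.eq_of_ctorIdx h
    exact hB (ν.var u) Fin.zero_ne_one.symm
  case star.star =>
    obtain ⟨rfl, ht⟩ := of_decide_eq_true h
    exact hB (ν.star r) ht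

lemma OPM.vec_ne_zero (M : OPM n) (ν : Assignment) (i : Fin M.rows × Fin 2) (j : Fin n) :
    M.vec ν i j ≠ 0 := by
  have hB : ∀ (B : QubitBasis) (k : Fin 2), B k ≠ 0 := fun B k => B.orthonormal.ne_zero k
  unfold OPM.vec
  cases M.entry i.1 j
  · exact hB stdBasis 0
  · exact hB stdBasis 1
  · exact hB _ 0
  · exact hB _ 1
  · exact hB _ i.2

lemma OPM.exists_proper {M : OPM n} {ν : Assignment} {ψ : QState n} (h : ψ ∈ M.states ν) :
    ∃ i, M.Proper i ∧ ψ = productState (M.vec ν i) := by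
  obtain ⟨r, t, rfl⟩ := h
  by_cases hp : M.Proper (r, t)
  · exact ⟨(r, t), hp, rfl⟩
  · refine ⟨(r, 0), .inl rfl, congrArg productState (funext fun j => ?_)⟩
    have hj : (M.entry r j).isStar ≠ true := fun h => hp (.inr ⟨j, h⟩)
    change (M.entry r j).vec ν r t = (M.entry r j).vec ν r 0
    cases he : M.entry r j <;> first | rfl | simp [he, Entry.isStar] at hj

lemma OPM.IsFormalOPB.orthogonal_index {M : OPM n} (hM : M.IsFormalOPB) (ν : Assignment)
    {i j : Fin M.rows × Fin 2} (hi : M.Proper i) (hj : M.Proper j) (hij : i ≠ j) :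
    star (productState (M.vec ν i)) ⬝ᵥ productState (M.vec ν j) = 0 := by
  obtain ⟨q, hq⟩ := hM.2 i j hi hj hij
  rw [productState_eq_tprod, productState_eq_tprod, star_tprod_dotProduct]
  exact Finset.prod_eq_zero (Finset.mem_univ q) (vec_orthogonal_of_orth ν hq)

lemma OPM.IsFormalOPB.orthogonal {M : OPM n} (hM : M.IsFormalOPB) (ν : Assignment) :
    ∀ ψ ∈ M.states ν, ∀ χ ∈ M.states ν, ψ ≠ χ → star ψ ⬝ᵥ χ = 0 := by
  intro ψ hψ χ hχ hne
  obtain ⟨i, hi, rfl⟩ := OPM.exists_proper hψ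
  obtain ⟨j, hj, rfl⟩ := OPM.exists_proper hχ
  exact hM.orthogonal_index ν hi hj fun h => hne (by rw [h])

lemma productState_vec_ne_zero (M : OPM n) (ν : Assignment) (i : Fin M.rows × Fin 2) :
    productState (M.vec ν i) ≠ 0 :=
  tprod_ne_zero fun j => ofLp_ne_zero (M.vec_ne_zero ν i j)

/-- `2 ^ n` orthogonal states span the space of `n` qubits. -/
lemma OPM.IsFormalOPB.span_eq_top {M : OPM n} (hM : M.IsFormalOPB) (ν : Assignment) :
    Submodule.span ℂ (M.states ν) = ⊤ := by
  set P : {i // M.Proper i} → QState n := fun i => productState (M.vec ν i) with hP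
  have hli : LinearIndependent ℂ P := by
    rw [Fintype.linearIndependent_iff]
    intro g hg i
    have h1 : star (P i) ⬝ᵥ ∑ j, g j • P j = 0 := by rw [hg, dotProduct_zero]
    rw [dotProduct_sum, Finset.sum_eq_single i, dotProduct_smul, smul_eq_mul] at h1
    · exact (mul_eq_zero.1 h1).resolve_right
        (star_dotProduct_self_ne_zero (productState_vec_ne_zero M ν i))
    · intro j _ hj
      rw [dotProduct_smul, hM.orthogonal_index ν i.2 j.2 fun h => hj (Subtype.ext h.symm),
        smul_zero]
    · exact fun h => absurd (Finset.mem_univ i) h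
  have hspan := hli.span_eq_top_of_card_eq_finrank' (by
    rw [Fintype.card_subtype, hM.1]
    simp)
  rw [eq_top_iff, ← hspan]
  refine Submodule.span_mono ?_
  rintro _ ⟨i, rfl⟩
  exact ⟨i.1.1, i.1.2, rfl⟩

/-- A locally distinguishable orthogonal product basis of four qubits splits. -/
theorem OPM.IsFormalOPB.splits {M : OPM 4} (hM : M.IsFormalOPB) (ν : Assignment)
    (h : LocallyDistinguishable (M.states ν)) : Splits (M.states ν) := by
  have hex : ∀ ψ : M.states ν, ∃ i, (ψ : QState 4) = productState (M.vec ν i) := by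
    rintro ⟨_, r, t, rfl⟩
    exact ⟨(r, t), rfl⟩
  choose f hf using hex
  obtain ⟨r, hr⟩ := h
  have hpos : (Finset.univ.filter M.Proper).Nonempty := Finset.card_pos.1 (by rw [hM.1]; norm_num)
  obtain ⟨⟨r₀, t₀⟩, -⟩ := hpos
  have : Nonempty (M.states ν) := ⟨⟨_, r₀, t₀, rfl⟩⟩
  have hval : (fun ψ : M.states ν => productState (M.vec ν (f ψ))) = Subtype.val :=
    funext fun ψ => (hf ψ).symm
  refine (tree_of_locc_of_span (v := fun ψ => M.vec ν (f ψ)) (r := r)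
    (fun ψ j => M.vec_ne_zero ν _ j) (fun ψ χ hne => ?_) ?_ ?_).splits hf
    fun ψ j => M.vec_ne_zero ν _ j
  · rw [← hf, ← hf]
    exact hM.orthogonal ν ψ ψ.2 χ χ.2 fun h => hne (Subtype.ext h)
  · rw [hval, Subtype.range_coe]
    exact hM.span_eq_top ν
  · convert hr using 2 with ψ
    rw [hf ψ]

end Symbolic

end QubitOPB

theorem theorem3 :
    (∀ M ∈ QubitOPB.firstSix, ∀ ν : QubitOPB.Assignment,
      QubitOPB.LocallyDistinguishable (M.states ν)) ∧
    (∀ M ∈ QubitOPB.remaining, ∀ ν : QubitOPB.Assignment,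
      QubitOPB.Splits (M.states ν) → QubitOPB.LocallyDistinguishable (M.states ν)) ∧
    (∀ M ∈ QubitOPB.remaining, ∀ ν : QubitOPB.Assignment,
      ¬ QubitOPB.Splits (M.states ν) → ¬ QubitOPB.LocallyDistinguishable (M.states ν)) := by
  refine ⟨fun M hM ν => QubitOPB.OPM.locallyDistinguishable_of_tree (QubitOPB.tree_firstSix hM ν),
    fun M hM ν h => ?_, fun M hM ν h hl => ?_⟩
  · have hOPB := QubitOPB.remaining_isFormalOPB M hM
    refine h.locallyDistinguishable (fun ψ hψ => ?_) (hOPB.orthogonal ν)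
    obtain ⟨r, t, rfl⟩ := hψ
    exact QubitOPB.productState_vec_ne_zero M ν (r, t)
  · exact h ((QubitOPB.remaining_isFormalOPB M hM).splits ν hl)
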